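/- **Setting.** Let $d\ge 1$, $r\ge 1$. Let $\mathcal T_h$ be a finite conforming simplicial mesh in $\mathbb R^d$ with maximal element diameter $h$, and let $\Omega$ be the bounded open polyhedral set that it triangulates (the interior of the union of its closed elements). Let $V^h\subseteq H^1_0(\Omega)$ be the continuous Lagrange finite element space of piecewise polynomials of degree $\le r$ vanishing on $\partial\Omega$, with nodal basis $\{\phi_l\}$ indexed by the degrees of freedom (Lagrange nodes in $\Omega$). Let $A:\Omega\to\mathbb R^{d\times d}$ (symmetric) and $n:\Omega\to\mathbb R$ be measurable with $|\xi|^2\le A(x)\xi\cdot\xi\le a_{\max}|\xi|^2$ for all $\xi\in\mathbb R^d$ and $0<n_{\min}\le n(x)\le 1$, for a.e. $x\in\Omega$, and let $k>0$. Let $\Omega_1^c,\dots,\Omega_N^c$ be open subsets of $\Omega$ with $\Omega=\bigcup_i\Omega_i^c$, each of them the interior of a union of closed mesh elements. For each $i$ put $\widetilde V_i=\{v|_{\Omega_i^c}:v\in V^h\}$, $\phi_l^i=\phi_l|_{\Omega_i^c}$, and let $\mathrm{dof}(\Omega_i^c)$ be the set of degrees of freedom $l$ with $\operatorname{supp}\phi_l\subseteq\overline{\Omega_i^c}$.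 For $u,v\in\widetilde V_i$ set $$b_i(u,v)=\int_{\Omega_i^c}\bigl(A\nabla u\cdot\nabla v-k^2n\,uv\bigr)\,dx,\qquad (u,v)_{1,k,\Omega_i^c}=\int_{\Omega_i^c}\bigl(A\nabla u\cdot\nabla v+k^2n\,uv\bigr)\,dx,$$ $$\Xi_i(v)=\sum_{l\in\mathrm{dof}(\Omega_i^c)}\frac1{\mu_l}\,v_l\,\phi^i_l,\qquad \mu_l=\#\{j: l\in\mathrm{dof}(\Omega_j^c)\},\qquad c_i(u,v)=(\Xi_i(u),\Xi_i(v))_{1,k,\Omega_i^c},$$ where $v_l$ is the value of $v$ at the node $l$. The local generalised eigenvalue problem (GEVP) is: find $p\in\widetilde V_i\setminus\{0\}$ and $\lambda\in\mathbb R$ with $b_i(p,v)=\lambda\,c_i(p,v)$ for all $v\in\widetilde V_i$. Let $n_i=\dim\widetilde V_i$, $\ker c_i=\{v\in\widetilde V_i: c_i(v,w)=0\ \forall w\in\widetilde V_i\}$, $s_i=\dim\ker c_i$. A *complete list of finite eigenvalues* is a sequence $\lambda^i_1\le\dots\le\lambda^i_{n_i-s_i}$ of real numbers for which there are $c_i$-orthonormal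 eigenvectors $p^i_1,\dots,p^i_{n_i-s_i}$ of the GEVP with eigenvalues $\lambda_m^i$. **Theorem (positivity of at least one eigenvalue).** There is a constant $C_{\mathrm{pos}}>0$, depending at most on $d$ and $r$ (in particular not on $k$, the mesh, $\Omega$, the coefficients or the subdomains), with the following property. Suppose that for each $i\in\{1,\dots,N\}$ there is a set $\mathcal D_i\subseteq\mathrm{dof}(\Omega_i^c)$ of $s_i+1$ degrees of freedom such that $\operatorname{supp}\phi^i_l\cap\operatorname{supp}\phi^i_{l'}$ has zero $d$-dimensional measure for all $l\neq l'$ in $\mathcal D_i$. If $(hk)^2\le C_{\mathrm{pos}}$, then for each $i\in\{1,\dots,N\}$: 1. the GEVP has an eigenpair $(\lambda,p)$ with $\lambda>0$ and $c_i(p,p)>0$; 2. for every complete list of finite eigenvalues there is at least one index $m_i\in\{1,\dots,n_i-s_i\}$ with $\lambda^i_{m_i}>0$; 3. a complete list of finite eigenvalues exists whenever $b_i$ is positive definite on $\ker c_i$; and $b_i$ is positive definite on $\ker c_i$ if $\Omega_i^c$ is connected and $(hk)^2\le C_1$, where $C_1>0$ depends only on $d$, $r$, the mesh and the subdomains (not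 on $k$, $A$, $n$). -/

import Mathlib

open MeasureTheory Set

noncomputable section

namespace HkGenEO

/-- Euclidean space `ℝ^d`. -/
abbrev Pt (d : ℕ) : Type := EuclideanSpace ℝ (Fin d)

/-- Geometric simplicial complexes in `ℝ^d`; they model conforming simplicial meshes
(no hanging nodes). -/
abbrev Mesh (d : ℕ) : Type := Geometry.SimplicialComplex ℝ (Pt d)

/-! ### Meshes -/

/-- The elements `T` of the mesh: the `d`-dimensional simplices, given by their vertices. -/
def elements {d : ℕ} (K : Mesh d) : Set (Finset (Pt d)) :=
  {T | T ∈ K.faces ∧ T.card = d + 1}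

/-- `K` is a finite conforming simplicial mesh of the (bounded, open, polyhedral) set `Ω`:
there are finitely many simplices, each of them is a face of a `d`-dimensional element, and
`Ω` is the interior of the union of the closed elements. -/
structure IsMeshOf {d : ℕ} (K : Mesh d) (Ω : Set (Pt d)) : Prop where
  finite : K.faces.Finite
  pure : ∀ s ∈ K.faces, ∃ T ∈ elements K, s ⊆ T
  domain : Ω = interior K.space

/-- The mesh size `h`, the maximum of the diameters of the elements. -/
def meshSize {d : ℕ} (K : Mesh d) : ℝ :=
  sSup ((fun T : Finset (Pt d) => Metric.diam (convexHull ℝ (T : Set (Pt d)))) '' elements K)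

/-- `Ω'` is (the interior of) a union of elements of the mesh `K`. -/
def IsMeshSubdomain {d : ℕ} (K : Mesh d) (Ω' : Set (Pt d)) : Prop :=
  ∃ S : Set (Finset (Pt d)), S ⊆ elements K ∧
    Ω' = interior (⋃ T ∈ S, convexHull ℝ (T : Set (Pt d)))

/-! ### Lagrange finite elements of degree `r` -/

/-- The function `v` coincides on `S` with a polynomial of total degree at most `r`. -/
def IsPolyOn {d : ℕ} (r : ℕ) (v : Pt d → ℝ) (S : Set (Pt d)) : Prop :=
  ∃ p : MvPolynomial (Fin d) ℝ, p.totalDegree ≤ r ∧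
    ∀ x ∈ S, v x = MvPolynomial.eval (fun i => x i) p

/-- The Lagrange finite element space `V^h ⊆ H^1_0(Ω)`: continuous functions that vanish on `∂Ω`
(and are extended by zero to all of `ℝ^d`) and that are polynomials of degree at most `r` on
each element. -/
def Vh {d : ℕ} (K : Mesh d) (r : ℕ) (Ω : Set (Pt d)) : Submodule ℝ (Pt d → ℝ) where
  carrier := {v | Continuous v ∧ (∀ x, x ∉ Ω → v x = 0) ∧
    ∀ T ∈ elements K, IsPolyOn r v (convexHull ℝ (T : Set (Pt d)))}
  zero_mem' := ⟨continuous_const, fun _ _ => rfl, fun _ _ => ⟨0, by simp, by simp⟩⟩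
  add_mem' := by
    rintro u v ⟨hu, hu0, hup⟩ ⟨hv, hv0, hvp⟩
    refine ⟨hu.add hv, fun x hx => by simp [hu0 x hx, hv0 x hx], fun T hT => ?_⟩
    obtain ⟨p, hp, hpe⟩ := hup T hT
    obtain ⟨q, hq, hqe⟩ := hvp T hT
    exact ⟨p + q, (MvPolynomial.totalDegree_add p q).trans (max_le hp hq),
      fun x hx => by simp [hpe x hx, hqe x hx]⟩
  smul_mem' := by
    rintro c v ⟨hv, hv0, hvp⟩
    refine ⟨hv.const_smul c, fun x hx => by simp [hv0 x hx], fun T hT => ?_⟩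
    obtain ⟨p, hp, hpe⟩ := hvp T hT
    exact ⟨c • p, (MvPolynomial.totalDegree_smul_le c p).trans hp,
      fun x hx => by simp [hpe x hx, MvPolynomial.smul_eval]⟩

/-- `w` is the family of barycentric coordinates of the point `x` in the mesh: nonnegative
weights with sum `1`, carried by the vertices of one simplex, with barycentre `x`. -/
def IsBary {d : ℕ} (K : Mesh d) (x : Pt d) (w : Pt d → ℝ) : Prop :=
  ∃ s ∈ K.faces, (∀ v ∈ s, 0 ≤ w v) ∧ (∀ v, v ∉ s → w v = 0) ∧
    ∑ v ∈ s, w v = 1 ∧ ∑ v ∈ s, w v • v = x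

/-- Barycentric coordinates are unique, so that `hat` below is well defined. -/
theorem IsBary.unique {d : ℕ} {K : Mesh d} {x : Pt d} {w w' : Pt d → ℝ}
    (h : IsBary K x w) (h' : IsBary K x w') : w = w' := by
  classical
  obtain ⟨s, hs, h0, hz, h1, hx⟩ := h
  obtain ⟨t, ht, h0', hz', h1', hx'⟩ := h'
  have key : ∀ (s : Finset (Pt d)) (_ : s ∈ K.faces) (u u' : Pt d → ℝ),
      (∀ v, v ∉ s → u v = 0) → (∀ v, v ∉ s → u' v = 0) → ∑ v ∈ s, u v = 1 → ∑ v ∈ s, u' v = 1 →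
      ∑ v ∈ s, u v • v = ∑ v ∈ s, u' v • v → u = u' := by
    intro s hs u u' hu hu' h1 h1' he
    have hi := K.indep hs
    rw [affineIndependent_iff] at hi
    have := hi (Finset.univ) (fun v => u v - u' v) (by
        rw [Finset.sum_sub_distrib, Finset.sum_coe_sort s u, Finset.sum_coe_sort s u', h1, h1', sub_self])
      (by
        simp only [sub_smul, Finset.sum_sub_distrib]
        rw [Finset.sum_coe_sort s (fun v => u v • v), Finset.sum_coe_sort s (fun v => u' v • v), he, sub_self])
    funext v
    by_cases hv : v ∈ s
    · exact sub_eq_zero.1 (this ⟨v, hv⟩ (Finset.mem_univ _))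
    · rw [hu v hv, hu' v hv]
  have hxs : x ∈ convexHull ℝ (s : Set (Pt d)) := by
    rw [Finset.mem_convexHull']; exact ⟨w, h0, h1, hx⟩
  have hxt : x ∈ convexHull ℝ (t : Set (Pt d)) := by
    rw [Finset.mem_convexHull']; exact ⟨w', h0', h1', hx'⟩
  have hi := K.inter_subset_convexHull hs ht ⟨hxs, hxt⟩
  rw [← Finset.coe_inter, Finset.mem_convexHull'] at hi
  obtain ⟨y, y0, y1, yx⟩ := hi
  let z : Pt d → ℝ := fun v => if v ∈ s ∩ t then y v else 0
  have sums : ∀ q : Finset (Pt d), s ∩ t ⊆ q → ∑ v ∈ q, z v = 1 ∧ ∑ v ∈ q, z v • v = x := by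
    intro q hq
    constructor
    · rw [← y1, ← Finset.sum_subset hq (f := z)]
      · exact Finset.sum_congr rfl fun v hv => by simp only [z, if_pos hv]
      · intro v _ hv; simp only [z, if_neg hv]
    · rw [← yx, ← Finset.sum_subset hq (f := fun v => z v • v)]
      · exact Finset.sum_congr rfl fun v hv => by simp only [z, if_pos hv]
      · intro v _ hv; simp only [z, if_neg hv, zero_smul]
  have a := key s hs w z hz (fun v hv => if_neg fun h => hv (Finset.mem_inter.1 h).1) h1
    (sums s Finset.inter_subset_left).1 (by rw [hx, (sums s Finset.inter_subset_left).2])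
  have b := key t ht w' z hz' (fun v hv => if_neg fun h => hv (Finset.mem_inter.1 h).2) h1'
    (sums t Finset.inter_subset_right).1 (by rw [hx', (sums t Finset.inter_subset_right).2])
  rw [a, b]

open Classical in
/-- `hat K v` is the piecewise affine hat function of the vertex `v`: its value at a point `x` of
the mesh is the `v`-th barycentric coordinate of `x` (these coordinates are unique); it is `0`
off the mesh. -/
def hat {d : ℕ} (K : Mesh d) (v x : Pt d) : ℝ :=
  if h : ∃ w, IsBary K x w then h.choose v else 0

/-- The Lagrange node with multi-index `α`, i.e. the point `∑_v (α_v / r) v`. -/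
def node {d : ℕ} (r : ℕ) (α : Pt d →₀ ℕ) : Pt d :=
  α.sum fun v m => ((m : ℝ) / r) • v

/-- The degrees of freedom of `V^h`: multi-indices `α` of length `r` that are supported on the
vertices of a simplex of the mesh and whose node does not lie on `∂Ω`. -/
def dofs {d : ℕ} (K : Mesh d) (r : ℕ) (Ω : Set (Pt d)) : Set (Pt d →₀ ℕ) :=
  {α | α.support ∈ K.faces ∧ (α.sum fun _ m => m) = r ∧ node r α ∈ Ω}

/-- The nodal (Lagrange) basis function `φ_α` of degree `r`, given by the classical formula
`∏_v ∏_{j < α_v} (r λ_v - j) / (α_v - j)` in terms of the hat functions `λ_v`. It is `1` at the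
node `α` and `0` at all other nodes. -/
def phi {d : ℕ} (K : Mesh d) (r : ℕ) (α : Pt d →₀ ℕ) (x : Pt d) : ℝ :=
  ∏ v ∈ α.support, ∏ j ∈ Finset.range (α v),
    ((r : ℝ) * hat K v x - (j : ℝ)) / ((α v : ℝ) - (j : ℝ))

/-- The hat functions at the nodes. -/
theorem hat_node {d r : ℕ} (hr : 1 ≤ r) {K : Mesh d} {Ω : Set (Pt d)} {α : Pt d →₀ ℕ} (h : α ∈ dofs K r Ω)
    (v : Pt d) : hat K v (node r α) = α v / r := by
  classical
  have hb : IsBary K (node r α) (fun v => (α v : ℝ) / r) := by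
    refine ⟨α.support, h.1, fun _ _ => by positivity, fun v hv => by
      simp [Finsupp.notMem_support_iff.1 hv], ?_, rfl⟩
    rw [← Finset.sum_div]
    have := h.2.1
    simp only [Finsupp.sum] at this
    rw [← Nat.cast_sum, this, div_self (by positivity)]
  have hex : ∃ w, IsBary K (node r α) w := ⟨_, hb⟩
  rw [hat, dif_pos hex, IsBary.unique hex.choose_spec hb]

/-- The Kronecker property of the nodal basis. -/
theorem phi_node {d r : ℕ} (hr : 1 ≤ r) {K : Mesh d} {Ω : Set (Pt d)} {α β : Pt d →₀ ℕ}
    (h : α ∈ dofs K r Ω) (h' : β ∈ dofs K r Ω) : phi K r α (node r β) = if α = β then 1 else 0 := by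
  classical
  have hr' : (r : ℝ) ≠ 0 := by positivity
  simp only [phi, hat_node hr h', mul_div_cancel₀ _ hr']
  split_ifs with e
  · subst e
    refine Finset.prod_eq_one fun v _ => Finset.prod_eq_one fun j hj => div_self ?_
    have : (j : ℝ) < α v := by exact_mod_cast Finset.mem_range.1 hj
    linarith
  · by_cases hlt : ∃ v ∈ α.support, β v < α v
    · obtain ⟨v, hv, hl⟩ := hlt
      refine Finset.prod_eq_zero hv (Finset.prod_eq_zero (Finset.mem_range.2 hl) (by simp))
    · exfalso; apply e
      push Not at hlt
      have hle : ∀ v, α v ≤ β v := fun v => by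
        by_cases hv : v ∈ α.support
        · exact hlt v hv
        · simp [Finsupp.notMem_support_iff.1 hv]
      have hs : α.support ⊆ β.support := fun v hv => by
        have := hle v; simp at hv ⊢; omega
      have e1 := h.2.1; have e2 := h'.2.1
      simp only [Finsupp.sum] at e1 e2
      rw [Finset.sum_subset hs (by intro v _ hv; simpa using hv)] at e1
      have := (Finset.sum_eq_sum_iff_of_le (fun v _ => hle v)).1 (e1.trans e2.symm)
      ext v
      by_cases hv : v ∈ β.support
      · exact this v hv
      · have := hle v; simp at hv; omega

/-- `dof(Ω')`: the degrees of freedom whose basis function is supported in the closure of `Ω'`. -/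
def dofInt {d : ℕ} (K : Mesh d) (r : ℕ) (Ω Ω' : Set (Pt d)) : Set (Pt d →₀ ℕ) :=
  {α | α ∈ dofs K r Ω ∧ tsupport (phi K r α) ⊆ closure Ω'}

/-- Restriction of functions to `Ω'`. A function on `Ω'` is represented by the function on `ℝ^d`
that has the same values on `Ω'` and is `0` elsewhere. -/
def restr {d : ℕ} (Ω' : Set (Pt d)) : (Pt d → ℝ) →ₗ[ℝ] (Pt d → ℝ) where
  toFun v := Ω'.indicator v
  map_add' u v := Set.indicator_add Ω' u v
  map_smul' c v := Set.indicator_const_smul Ω' c v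

/-- The local space `{v|_Ω' : v ∈ V^h}` (no boundary condition on `∂Ω' ∩ Ω`). -/
def Vtilde {d : ℕ} (K : Mesh d) (r : ℕ) (Ω Ω' : Set (Pt d)) : Submodule ℝ (Pt d → ℝ) :=
  (Vh K r Ω).map (restr Ω')

/-! ### Coefficients and bilinear forms -/

/-- The assumptions on the coefficients in `Ω`: `A` and `n` are measurable, `A` is symmetric,
`|ξ|² ≤ A(x) ξ · ξ ≤ amax |ξ|²` and `0 < nmin ≤ n(x) ≤ 1` for almost every `x ∈ Ω`
(that is, normalised such that `amin = 1` and `nmax = 1`). -/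
structure IsCoefficients {d : ℕ} (Ω : Set (Pt d)) (A : Pt d → Matrix (Fin d) (Fin d) ℝ)
    (n : Pt d → ℝ) (amax nmin : ℝ) : Prop where
  measurable_A : ∀ i j, AEMeasurable (fun x => A x i j) (volume.restrict Ω)
  measurable_n : AEMeasurable n (volume.restrict Ω)
  symm : ∀ᵐ x ∂(volume.restrict Ω), (A x).IsSymm
  bounds_A : ∀ᵐ x ∂(volume.restrict Ω), ∀ ξ : Fin d → ℝ,
    ξ ⬝ᵥ ξ ≤ (A x).mulVec ξ ⬝ᵥ ξ ∧ (A x).mulVec ξ ⬝ᵥ ξ ≤ amax * (ξ ⬝ᵥ ξ)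
  nmin_pos : 0 < nmin
  bounds_n : ∀ᵐ x ∂(volume.restrict Ω), nmin ≤ n x ∧ n x ≤ 1

/-- `a_Ω'(u,v) = ∫_Ω' A ∇u · ∇v`. The functions in this development are piecewise polynomial,
so that the weak gradient is the classical gradient, which exists almost everywhere. -/
def aForm {d : ℕ} (A : Pt d → Matrix (Fin d) (Fin d) ℝ) (Ω' : Set (Pt d))
    (u v : Pt d → ℝ) : ℝ :=
  ∫ x in Ω', (A x).mulVec (gradient u x).ofLp ⬝ᵥ (gradient v x).ofLp

/-- The weighted `L²` inner product `(u,v)_{n,Ω'} = ∫_Ω' n u v`. -/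
def nForm {d : ℕ} (n : Pt d → ℝ) (Ω' : Set (Pt d)) (u v : Pt d → ℝ) : ℝ :=
  ∫ x in Ω', n x * u x * v x

/-- `b_Ω'(u,v) = a_Ω'(u,v) - k² (u,v)_{n,Ω'}`. -/
def bForm {d : ℕ} (A : Pt d → Matrix (Fin d) (Fin d) ℝ) (n : Pt d → ℝ) (k : ℝ)
    (Ω' : Set (Pt d)) (u v : Pt d → ℝ) : ℝ :=
  aForm A Ω' u v - k ^ 2 * nForm n Ω' u v

/-- `(u,v)_{1,k,Ω'} = a_Ω'(u,v) + k² (u,v)_{n,Ω'}`. -/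
def energyForm {d : ℕ} (A : Pt d → Matrix (Fin d) (Fin d) ℝ) (n : Pt d → ℝ) (k : ℝ)
    (Ω' : Set (Pt d)) (u v : Pt d → ℝ) : ℝ :=
  aForm A Ω' u v + k ^ 2 * nForm n Ω' u v

/-! ### The local generalised eigenvalue problems -/

/-- `μ_α`: the number of coarse subdomains for which `α` is an internal degree of freedom. -/
def mu {d N : ℕ} (K : Mesh d) (r : ℕ) (Ω : Set (Pt d)) (Ωc : Fin N → Set (Pt d))
    (α : Pt d →₀ ℕ) : ℕ :=
  {i : Fin N | α ∈ dofInt K r Ω (Ωc i)}.ncard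

/-- The partition of unity operator
`Ξ_i(v) = ∑_{α ∈ dof(Ωc i)} (1 / μ_α) v_α φ_α|_{Ωc i}`; the coefficient `v_α` of `v` is its value
at the node `α`, which lies in `Ωc i`. The sum is finite. -/
def Xi {d N : ℕ} (K : Mesh d) (r : ℕ) (Ω : Set (Pt d)) (Ωc : Fin N → Set (Pt d)) (i : Fin N)
    (v : Pt d → ℝ) : Pt d → ℝ :=
  ∑ᶠ α ∈ dofInt K r Ω (Ωc i),
    ((mu K r Ω Ωc α : ℝ)⁻¹ * v (node r α)) • restr (Ωc i) (phi K r α)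

/-- `c_i(w,v) = (Ξ_i(w), Ξ_i(v))_{1,k,Ωc i}`. -/
def cForm {d N : ℕ} (K : Mesh d) (r : ℕ) (Ω : Set (Pt d))
    (A : Pt d → Matrix (Fin d) (Fin d) ℝ) (n : Pt d → ℝ) (k : ℝ)
    (Ωc : Fin N → Set (Pt d)) (i : Fin N) (w v : Pt d → ℝ) : ℝ :=
  energyForm A n k (Ωc i) (Xi K r Ω Ωc i w) (Xi K r Ω Ωc i v)

/-- The kernel `{v ∈ V : c(v,w) = 0 for all w ∈ V}` of a symmetric bilinear form on `V`. -/
def kerForm {X : Type*} [AddCommGroup X] [Module ℝ X] (V : Submodule ℝ X) (c : X → X → ℝ) :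
    Set X :=
  {v | v ∈ V ∧ ∀ w ∈ V, c v w = 0}

/-- `(lam, p)` is an eigenpair of the generalised eigenvalue problem: find `p ∈ V \ {0}` and
`lam ∈ ℝ` with `b(p,v) = lam c(p,v)` for all `v ∈ V`. -/
def IsEigenpair {X : Type*} [AddCommGroup X] [Module ℝ X] (V : Submodule ℝ X) (b c : X → X → ℝ)
    (lam : ℝ) (p : X) : Prop :=
  p ∈ V ∧ p ≠ 0 ∧ ∀ v ∈ V, b p v = lam * c p v

/-- A complete ordered system of finite eigenvalues `lam 0 ≤ lam 1 ≤ …`, of length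
`dim V - dim ker c`, with `c`-orthonormal eigenvectors. -/
structure IsEigensystem {X : Type*} [AddCommGroup X] [Module ℝ X] (V : Submodule ℝ X)
    (b c : X → X → ℝ)
    (lam : Fin (Module.finrank ℝ V - Set.finrank ℝ (kerForm V c)) → ℝ)
    (p : Fin (Module.finrank ℝ V - Set.finrank ℝ (kerForm V c)) → X) : Prop where
  mono : Monotone lam
  eigenpair : ∀ m, IsEigenpair V b c (lam m) (p m)
  orthonormal : ∀ m m', c (p m) (p m') = if m = m' then 1 else 0

end HkGenEO

end

open HkGenEO

namespace HkGenEO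

/-! ### Polynomials on convex bodies -/

/-! A nodal function vanishes at some vertex of every element, so an elementwise Poincaré inequality
gives `‖φ‖² ≤ C h² ‖∇φ‖²`. Since `A ≥ 1` and `n ≤ 1`, its energy `b_i(φ, φ)` is positive once `(hk)²
≤ 1/(2C)` (`bForm_phi_pos`). The constant needs no shape regularity: near a maximum point of a
polynomial, a homothetic copy of the convex element carries a fixed fraction of both the volume and
the maximum. This makes `exists_sq_le_setIntegral` and `exists_sub_sq_le_setIntegral` uniform over
all convex bodies.

Basis functions with null overlap are `b_i`-orthogonal, so `b_i` is positive definite on a space `W`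
of dimension `s_i + 1 > dim ker c_i`. The rest is linear algebra (`exists_pos_eigenpair`). Let `Z =
ker c` and let `Y` be its `b`-orthogonal complement. By dimension, `W` meets `Y`. On a complement of
`Z ∩ Y` in `Y` the form `c` is definite and the pencil diagonalises; a vector of `W ∩ Y` forces a
positive eigenvalue. The eigenvalue equation then holds against `Y`, and a correction by an element
of `Z`, invisible to `c`, extends it to all test vectors. Nothing is assumed about `b` on `Z`.

A `c`-orthonormal eigensystem of full length spans a complement of `ker c`, so it must contain this
eigenvalue (`exists_eq_of_eigensystem`). If `b` is definite on `Z`, the space splits as `Z ⊕ Y` and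
diagonalising on `Y` gives a full system (`exists_eigensystem`). Definiteness on `Z` for small `hk`
holds because elements of `ker c_i` vanish at interior nodes; on a connected subdomain the Dirichlet
integral is then definite, and finite dimension supplies a constant independent of the coefficients
(`exists_uniform_threshold`). -/

/-- Polynomials of bounded degree cannot vary quickly near `0` relative to their size
on `[0, 1]`. -/
theorem exists_abs_eval_sub_le (r : ℕ) : ∃ ε : ℝ, 0 < ε ∧ ε ≤ 1 ∧ ∀ q : Polynomial ℝ,
    q.natDegree ≤ r → ∀ M : ℝ, (∀ t ∈ Icc (0 : ℝ) 1, |q.eval t| ≤ M) →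
      ∀ t ∈ Icc (0 : ℝ) ε, |q.eval t - q.eval 0| ≤ M / 2 := by
  classical
  let v : ℕ → ℝ := fun j => j / (r + 1)
  let s := Finset.range (r + 1)
  have hr : (0 : ℝ) < r + 1 := by positivity
  have hv : Set.InjOn v s := by
    intro i _ j _ h
    have : (i : ℝ) = j := by simpa [v, div_left_inj' hr.ne'] using h
    exact_mod_cast this
  have hv1 : ∀ j ∈ s, v j ∈ Icc (0 : ℝ) 1 := by
    intro j hj
    have : (j : ℝ) ≤ r := by exact_mod_cast Nat.lt_succ_iff.1 (Finset.mem_range.1 hj)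
    exact ⟨by positivity, by rw [div_le_one hr]; linarith⟩
  -- By interpolation at the `r + 1` points `v j`, the variation of `q` from `0` to `t` is at most
  -- `M * F t`. As `F` depends only on `r` and `F 0 = 0`, continuity yields `ε`.
  let F : ℝ → ℝ := fun t =>
    ∑ j ∈ s, |(Lagrange.basis s v j).eval t - (Lagrange.basis s v j).eval 0|
  have hF : Continuous F := by
    refine continuous_finsetSum _ fun j _ => Continuous.abs ?_
    exact (Polynomial.continuous _).sub continuous_const
  have hF0 : F 0 = 0 := by simp [F]
  have := hF.continuousAt (x := 0)
  rw [Metric.continuousAt_iff] at this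
  obtain ⟨δ, hδ, hδF⟩ := this (1 / 2) (by norm_num)
  -- Halving `δ` fits the closed interval into the open ball; the cap `1` keeps later homotheties
  -- inside the body.
  refine ⟨min (δ / 2) 1, by positivity, min_le_right _ _, fun q hq M hM t ht => ?_⟩
  have hM0 : 0 ≤ M := (abs_nonneg _).trans (hM 0 (by simp))
  have hqe : q = Lagrange.interpolate s v fun j => q.eval (v j) := by
    refine Lagrange.eq_interpolate hv ?_
    refine lt_of_le_of_lt Polynomial.degree_le_natDegree ?_
    simp only [s, Finset.card_range]
    exact_mod_cast Nat.lt_succ_iff.2 hq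
  have he : ∀ t, q.eval t = ∑ j ∈ s, q.eval (v j) * (Lagrange.basis s v j).eval t := by
    intro t
    conv_lhs => rw [hqe]
    simp [Lagrange.interpolate_apply, Polynomial.eval_finsetSum]
  have hFt : F t ≤ 1 / 2 := by
    have h1 : dist t 0 < δ := by
      rw [Real.dist_eq, sub_zero, abs_of_nonneg ht.1]
      linarith [ht.2.trans (min_le_left _ _)]
    have := hδF h1
    rw [hF0, Real.dist_eq, sub_zero] at this
    linarith [le_abs_self (F t)]
  calc |q.eval t - q.eval 0| = |∑ j ∈ s, q.eval (v j) *
        ((Lagrange.basis s v j).eval t - (Lagrange.basis s v j).eval 0)| := by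
        rw [he t, he 0, ← Finset.sum_sub_distrib]; simp only [mul_sub]
    _ ≤ ∑ j ∈ s, M * |(Lagrange.basis s v j).eval t - (Lagrange.basis s v j).eval 0| := by
        refine (Finset.abs_sum_le_sum_abs _ _).trans (Finset.sum_le_sum fun j hj => ?_)
        rw [abs_mul]
        exact mul_le_mul_of_nonneg_right (hM _ (hv1 j hj)) (abs_nonneg _)
    _ = M * F t := by rw [Finset.mul_sum]
    _ ≤ M / 2 := by nlinarith

/-- Evaluation of a multivariate polynomial at a point of Euclidean space. -/
noncomputable def polyFun {d : ℕ} (p : MvPolynomial (Fin d) ℝ) (x : Pt d) : ℝ :=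
  MvPolynomial.eval (fun i => x i) p

theorem continuous_polyFun {d : ℕ} (p : MvPolynomial (Fin d) ℝ) : Continuous (polyFun p) :=
  (MvPolynomial.continuous_eval p).comp (PiLp.continuous_ofLp 2 _)

/-- The gradient of a polynomial. -/
noncomputable def polyGrad {d : ℕ} (p : MvPolynomial (Fin d) ℝ) (x : Pt d) : Pt d :=
  WithLp.toLp 2 fun i => polyFun (MvPolynomial.pderiv i p) x

theorem continuous_polyGrad {d : ℕ} (p : MvPolynomial (Fin d) ℝ) : Continuous (polyGrad p) :=
  (PiLp.continuous_toLp 2 _).comp (continuous_pi fun _ => continuous_polyFun _)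

theorem hasGradientAt_polyFun {d : ℕ} (p : MvPolynomial (Fin d) ℝ) (x : Pt d) :
    HasGradientAt (polyFun p) (polyGrad p x) x := by
  rw [hasGradientAt_iff_hasFDerivAt]
  induction p using MvPolynomial.induction_on with
  | C a =>
    have : polyFun (MvPolynomial.C a : MvPolynomial (Fin d) ℝ) = fun _ => a := by
      funext x; simp [polyFun]
    rw [this]
    have h0 : polyGrad (MvPolynomial.C a : MvPolynomial (Fin d) ℝ) x = 0 := by
      ext i; simp [polyGrad, polyFun]
    rw [h0, map_zero]
    exact hasFDerivAt_const a x
  | add p q hp hq =>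
    have : polyFun (p + q) = fun x => polyFun p x + polyFun q x := by
      funext x; simp [polyFun]
    rw [this]
    convert! hp.add hq using 1
    rw [← map_add]
    congr 1
    ext i; simp [polyGrad, polyFun]
  | mul_X p i hp =>
    have : polyFun (p * MvPolynomial.X i) = fun x => polyFun p x * x i := by
      funext x; simp [polyFun]
    rw [this]
    have hi : HasFDerivAt (fun x : Pt d => x i) (EuclideanSpace.proj i : Pt d →L[ℝ] ℝ) x :=
      (EuclideanSpace.proj i : Pt d →L[ℝ] ℝ).hasFDerivAt
    convert! hp.mul hi using 1
    ext y
    simp only [InnerProductSpace.toDual_apply_apply, PiLp.inner_apply, polyGrad, polyFun,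
      add_apply, smul_apply, smul_eq_mul, map_mul,
      MvPolynomial.eval_X, map_add, Derivation.leibniz, MvPolynomial.pderiv_X, RCLike.inner_apply,
      conj_trivial, mul_add, Finset.sum_add_distrib, Finset.mul_sum]
    congr 1
    · rw [Finset.sum_eq_single i]
      · simp [mul_comm]
      · intro j _ hj; simp [hj.symm]
      · simp
    · exact Finset.sum_congr rfl fun j _ => by ring

/-- The drop in degree is not needed: this bound lets the constant for degree `r` serve the partial
derivatives too. -/
theorem totalDegree_pderiv_le {d : ℕ} (i : Fin d) (p : MvPolynomial (Fin d) ℝ) :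
    (MvPolynomial.pderiv i p).totalDegree ≤ p.totalDegree := by
  classical
  conv_lhs => rw [p.as_sum, map_sum]
  refine MvPolynomial.totalDegree_finsetSum_le fun m hm => ?_
  rw [MvPolynomial.pderiv_monomial]
  refine (MvPolynomial.totalDegree_monomial_le _ _).trans ?_
  refine le_trans ?_ (MvPolynomial.le_totalDegree hm)
  change (m - Finsupp.single i 1).degree ≤ m.degree
  rw [Finsupp.degree_eq_sum, Finsupp.degree_eq_sum]
  exact Finset.sum_le_sum fun j _ => by simp

/-- The restriction of a polynomial to a line. -/
theorem exists_polyFun_line {d r : ℕ} {p : MvPolynomial (Fin d) ℝ} (hp : p.totalDegree ≤ r)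
    (x z : Pt d) : ∃ q : Polynomial ℝ, q.natDegree ≤ r ∧
      ∀ t : ℝ, q.eval t = polyFun p (x + t • (z - x)) := by
  refine ⟨MvPolynomial.aeval (fun i => Polynomial.C (x i) +
    Polynomial.C (z i - x i) * Polynomial.X) p, ?_, fun t => ?_⟩
  · have := MvPolynomial.aeval_natDegree_le p hp (fun i => Polynomial.C (x i) +
      Polynomial.C (z i - x i) * Polynomial.X) (n := 1) fun i => by compute_degree
    simpa using this
  · rw [polyFun, ← Polynomial.coe_evalRingHom, MvPolynomial.aeval_def, MvPolynomial.hom_eval₂,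
      MvPolynomial.eval, MvPolynomial.eval₂Hom, RingHom.coe_mk]
    change MvPolynomial.eval₂ _ _ _ = MvPolynomial.eval₂ _ _ _
    congr 1
    · ext a; simp
    · funext i; simp; ring

/-- The maximum of a polynomial over a convex body is controlled by its mean square, uniformly
over all convex bodies. -/
theorem exists_sq_le_setIntegral (d r : ℕ) : ∃ C : ℝ, 0 < C ∧ ∀ p : MvPolynomial (Fin d) ℝ,
    p.totalDegree ≤ r → ∀ T : Set (Pt d), Convex ℝ T → IsCompact T → ∀ x ∈ T,
      volume.real T * polyFun p x ^ 2 ≤ C * ∫ y in T, polyFun p y ^ 2 := by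
  obtain ⟨ε, hε, hε1, H⟩ := exists_abs_eval_sub_le r
  -- The `4` comes from squaring `|p| ≥ M / 2`, the `ε ^ d` from the volume of the homothetic copy.
  refine ⟨4 / ε ^ d, by positivity, fun p hp T hT hTc x hx => ?_⟩
  obtain ⟨z, hz, hmax⟩ := hTc.exists_isMaxOn ⟨x, hx⟩ (continuous_polyFun p).abs.continuousOn
  set M := |polyFun p z| with hM
  have hM0 : 0 ≤ M := abs_nonneg _
  -- The centre is a maximum point of `|p|`. On each segment from `z`, the one-variable bound keeps
  -- `|p| ≥ M / 2` up to parameter `ε`.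
  set T' := AffineMap.homothety z ε '' T with hT'
  have hsub : T' ⊆ T := by
    rintro _ ⟨y, hy, rfl⟩
    rw [AffineMap.homothety_eq_lineMap]
    exact hT.lineMap_mem hz hy ⟨hε.le, hε1⟩
  have hT'c : IsCompact T' := hTc.image (AffineMap.homothety_continuous z ε)
  have hlow : ∀ y ∈ T', M ^ 2 / 4 ≤ polyFun p y ^ 2 := by
    rintro _ ⟨y, hy, rfl⟩
    obtain ⟨q, hq, hqe⟩ := exists_polyFun_line hp z y
    have hb : ∀ t ∈ Icc (0 : ℝ) 1, |q.eval t| ≤ M := by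
      intro t ht
      rw [hqe]
      refine hmax ?_
      have := hT.lineMap_mem hz hy ht
      rwa [AffineMap.lineMap_apply, vsub_eq_sub, vadd_eq_add, add_comm] at this
    have h1 := H q hq M hb ε ⟨hε.le, le_rfl⟩
    rw [hqe, hqe, zero_smul, add_zero] at h1
    rw [AffineMap.homothety_apply, vsub_eq_sub, vadd_eq_add, add_comm]
    have h2 : M / 2 ≤ |polyFun p (z + ε • (y - z))| := by
      have := abs_sub_abs_le_abs_sub (polyFun p z) (polyFun p (z + ε • (y - z)))
      rw [abs_sub_comm] at this
      linarith
    rw [← sq_abs (polyFun p _)]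
    nlinarith
  have hint : IntegrableOn (fun y => polyFun p y ^ 2) T :=
    ((continuous_polyFun p).pow 2).continuousOn.integrableOn_compact hTc
  have hvol : volume.real T' = ε ^ d * volume.real T := by
    rw [Measure.real, hT', Measure.addHaar_image_homothety]
    simp [Measure.real, abs_of_pos hε, hε.le]
  have h1 : volume.real T' * (M ^ 2 / 4) ≤ ∫ y in T', polyFun p y ^ 2 := by
    have := setIntegral_mono_on (μ := volume) (s := T') (f := fun _ => M ^ 2 / 4)
      (g := fun y => polyFun p y ^ 2)
      (integrableOn_const (hs := hT'c.measure_lt_top.ne)) (hint.mono_set hsub)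
      hT'c.measurableSet hlow
    simpa [setIntegral_const] using this
  have h2 : ∫ y in T', polyFun p y ^ 2 ≤ ∫ y in T, polyFun p y ^ 2 :=
    setIntegral_mono_set hint (Filter.Eventually.of_forall fun y => sq_nonneg _)
      (Filter.Eventually.of_forall hsub)
  have h3 : polyFun p x ^ 2 ≤ M ^ 2 := by
    rw [← sq_abs]; exact pow_le_pow_left₀ (abs_nonneg _) (hmax hx) 2
  have h4 : 0 ≤ volume.real T := measureReal_nonneg
  rw [hvol] at h1
  rw [div_mul_eq_mul_div, le_div_iff₀ (by positivity)]
  calc volume.real T * polyFun p x ^ 2 * ε ^ d ≤ volume.real T * M ^ 2 * ε ^ d := by gcongr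
    _ = 4 * (ε ^ d * volume.real T * (M ^ 2 / 4)) := by ring
    _ ≤ 4 * ∫ y in T, polyFun p y ^ 2 := by linarith

/-- A pointwise Poincaré inequality for polynomials, uniform over all convex bodies. -/
theorem exists_sub_sq_le_setIntegral (d r : ℕ) : ∃ C : ℝ, 0 < C ∧
    ∀ p : MvPolynomial (Fin d) ℝ, p.totalDegree ≤ r → ∀ T : Set (Pt d), Convex ℝ T →
      IsCompact T → ∀ x ∈ T, ∀ y ∈ T,
        volume.real T * (polyFun p x - polyFun p y) ^ 2 ≤
          C * Metric.diam T ^ 2 * ∫ z in T, ‖polyGrad p z‖ ^ 2 := by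
  obtain ⟨C, hC, H⟩ := exists_sq_le_setIntegral d r
  refine ⟨C, hC, fun p hp T hT hTc x hx y hy => ?_⟩
  obtain ⟨w, hw, hmax⟩ := hTc.exists_isMaxOn ⟨x, hx⟩ (continuous_polyGrad p).norm.continuousOn
  have h1 : |polyFun p x - polyFun p y| ≤ ‖polyGrad p w‖ * Metric.diam T := by
    have := hT.norm_image_sub_le_of_norm_hasFDerivWithin_le (f := polyFun p)
      (C := ‖polyGrad p w‖)
      (fun z _ => (hasGradientAt_polyFun p z).hasFDerivAt.hasFDerivWithinAt)
      (fun z hz => by rw [LinearIsometryEquiv.norm_map]; exact hmax hz) hy hx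
    rw [Real.norm_eq_abs] at this
    refine this.trans ?_
    rw [← dist_eq_norm]
    gcongr
    exact Metric.dist_le_diam_of_mem hTc.isBounded hx hy
  have hn : ∀ z, ‖polyGrad p z‖ ^ 2 = ∑ i, polyFun (MvPolynomial.pderiv i p) z ^ 2 := by
    intro z
    rw [EuclideanSpace.real_norm_sq_eq]; rfl
  -- All partial derivatives are estimated at the same point `w`, so summing them costs no extra
  -- factor.
  have h2 : volume.real T * ‖polyGrad p w‖ ^ 2 ≤ C * ∫ z in T, ‖polyGrad p z‖ ^ 2 := by
    simp only [hn]
    rw [integral_finsetSum _ fun i _ => ?_, Finset.mul_sum, Finset.mul_sum]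
    · exact Finset.sum_le_sum fun i _ =>
        H _ ((totalDegree_pderiv_le i p).trans hp) T hT hTc w hw
    · exact ((continuous_polyFun _).pow 2).continuousOn.integrableOn_compact hTc
  have h3 : (polyFun p x - polyFun p y) ^ 2 ≤ ‖polyGrad p w‖ ^ 2 * Metric.diam T ^ 2 := by
    rw [← sq_abs, ← mul_pow]; exact pow_le_pow_left₀ (abs_nonneg _) h1 2
  have h4 : 0 ≤ volume.real T := measureReal_nonneg
  calc _ ≤ volume.real T * (‖polyGrad p w‖ ^ 2 * Metric.diam T ^ 2) := by gcongr
    _ = (volume.real T * ‖polyGrad p w‖ ^ 2) * Metric.diam T ^ 2 := by ring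
    _ ≤ (C * ∫ z in T, ‖polyGrad p z‖ ^ 2) * Metric.diam T ^ 2 := by gcongr
    _ = _ := by ring

/-! ### Pencils of symmetric bilinear forms -/

section Pencil

variable {E : Type*} [AddCommGroup E] [Module ℝ E]

/-- A positive semidefinite symmetric form degenerates exactly on its isotropic vectors. -/
theorem apply_eq_zero_of_apply_self_eq_zero {C : E →ₗ[ℝ] E →ₗ[ℝ] ℝ}
    (hC : ∀ u v, C u v = C v u) (hC0 : ∀ v, 0 ≤ C v v) {v : E} (hv : C v v = 0) : C v = 0 := by
  ext w
  have h : ∀ t : ℝ, 0 ≤ 2 * t * C v w + C w w := by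
    intro t
    have := hC0 (t • v + w)
    simp only [map_add, map_smul, LinearMap.add_apply, LinearMap.smul_apply, smul_eq_mul, hv, hC w v] at this
    linarith
  by_contra hne
  -- An affine function of `t` that is nonnegative everywhere has slope zero; this `t` would give it
  -- the value `-1`.
  have h1 := h (-(C w w + 1) / (2 * C v w))
  have hne' : C v w ≠ 0 := hne
  field_simp at h1
  linarith

/-- Simultaneous diagonalisation of a symmetric form and a symmetric positive definite form. -/
theorem exists_basis_diagonal [FiniteDimensional ℝ E] {B C : E →ₗ[ℝ] E →ₗ[ℝ] ℝ}
    (hB : ∀ u v, B u v = B v u) (hC : ∀ u v, C u v = C v u) (hpos : ∀ v, v ≠ 0 → 0 < C v v)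
    {m : ℕ} (hm : Module.finrank ℝ E = m) :
    ∃ (e : Module.Basis (Fin m) ℝ E) (lam : Fin m → ℝ), Monotone lam ∧
      (∀ i j, C (e i) (e j) = if i = j then 1 else 0) ∧
      ∀ i v, B (e i) v = lam i * C (e i) v := by
  let core : InnerProductSpace.Core ℝ E :=
    { inner := fun x y => C x y
      conj_inner_symm := fun x y => by simp [hC x y]
      re_inner_nonneg := fun x => by
        by_cases h : x = 0
        · simp [h]
        · exact (hpos x h).le
      add_left := fun x y z => by simp
      smul_left := fun x y r => by simp
      definite := fun x hx => by
        by_contra h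
        exact (hpos x h).ne' hx }
  let _ : NormedAddCommGroup E := core.toNormedAddCommGroup
  let _ : InnerProductSpace ℝ E := InnerProductSpace.ofCore core.toCore
  have hin : ∀ x y : E, inner ℝ x y = C x y := fun _ _ => rfl
  have hinj : Function.Injective C := by
    refine (injective_iff_map_eq_zero C).2 fun x hx => ?_
    by_contra h
    have := hpos x h
    simp [hx] at this
  let c : E ≃ₗ[ℝ] (Module.Dual ℝ E) :=
    LinearMap.linearEquivOfInjective C hinj (Subspace.dual_finrank_eq).symm
  -- The sign is reversed because the spectral theorem lists eigenvalues in decreasing order.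
  let T : E →ₗ[ℝ] E := c.symm.toLinearMap ∘ₗ (-B)
  have hT : ∀ x y, C (T x) y = - B x y := by
    intro x y
    have : C (T x) = (-B) x := c.apply_symm_apply ((-B) x)
    rw [this]; rfl
  have hs : T.IsSymmetric := by
    intro x y
    rw [hin, hin, hT, hC x, hT, hB]
  refine ⟨(hs.eigenvectorBasis hm).toBasis, fun i => - hs.eigenvalues hm i,
    fun i j hij => neg_le_neg (hs.eigenvalues_antitone hm hij), fun i j => ?_, fun i v => ?_⟩
  · rw [← hin]
    simpa using orthonormal_iff_ite.1 (hs.eigenvectorBasis hm).orthonormal i j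
  · have h1 := hT (hs.eigenvectorBasis hm i) v
    rw [hs.apply_eigenvectorBasis] at h1
    simp only [OrthonormalBasis.coe_toBasis]
    simp only [RCLike.ofReal_real_eq_id, id_eq, map_smul, LinearMap.smul_apply, smul_eq_mul] at h1
    linarith

/-- Parseval: by `C`-orthonormality the `i`-th coordinate of `v` is `C (e i) v`. -/
theorem apply_self_of_basis_diagonal {B C : E →ₗ[ℝ] E →ₗ[ℝ] ℝ} {m : ℕ}
    {e : Module.Basis (Fin m) ℝ E} {lam : Fin m → ℝ}
    (h1 : ∀ i j, C (e i) (e j) = if i = j then 1 else 0)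
    (h2 : ∀ i v, B (e i) v = lam i * C (e i) v) (v : E) :
    B v v = ∑ i, lam i * e.repr v i ^ 2 ∧ C v v = ∑ i, e.repr v i ^ 2 := by
  have hc : ∀ i, C (e i) v = e.repr v i := by
    intro i
    have := congrArg (C (e i)) (e.sum_repr v)
    rw [map_sum] at this
    simpa only [map_smul, h1, smul_eq_mul, mul_ite, mul_one, mul_zero, Finset.sum_ite_eq,
      Finset.mem_univ, if_true] using this.symm
  have key : ∀ F : E →ₗ[ℝ] E →ₗ[ℝ] ℝ, F v v = ∑ i, e.repr v i * F (e i) v := by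
    intro F
    have := LinearMap.congr_fun (congrArg F (e.sum_repr v)) v
    rw [map_sum, LinearMap.sum_apply] at this
    rw [← this]
    exact Finset.sum_congr rfl fun i _ => by simp
  constructor
  · rw [key B]; exact Finset.sum_congr rfl fun i _ => by rw [h2, hc]; ring
  · rw [key C]; exact Finset.sum_congr rfl fun i _ => by rw [hc]; ring

/-- On a finite-dimensional space every symmetric form is bounded by any positive definite
one. -/
theorem exists_apply_self_le [FiniteDimensional ℝ E] {L G : E →ₗ[ℝ] E →ₗ[ℝ] ℝ}
    (hL : ∀ u v, L u v = L v u) (hG : ∀ u v, G u v = G v u) (hpos : ∀ v, v ≠ 0 → 0 < G v v) :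
    ∃ c : ℝ, 0 < c ∧ ∀ v, L v v ≤ c * G v v := by
  obtain ⟨e, lam, -, h1, h2⟩ := exists_basis_diagonal hL hG hpos rfl
  -- The summand `1` keeps the constant positive even if every `lam i` vanishes.
  refine ⟨1 + ∑ i, |lam i|, by positivity, fun v => ?_⟩
  obtain ⟨hb, hc⟩ := apply_self_of_basis_diagonal h1 h2 v
  rw [hb, hc, Finset.mul_sum]
  refine Finset.sum_le_sum fun i _ => mul_le_mul_of_nonneg_right ?_ (sq_nonneg _)
  have : |lam i| ≤ ∑ i, |lam i| :=
    Finset.single_le_sum (f := fun i => |lam i|) (fun _ _ => abs_nonneg _) (Finset.mem_univ i)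
  linarith [le_abs_self (lam i)]

variable [FiniteDimensional ℝ E] {B C : E →ₗ[ℝ] E →ₗ[ℝ] ℝ}

/-- If `B` is positive definite on a subspace of dimension larger than that of `ker C`, then the
pencil of `B` and `C` has a positive finite eigenvalue, whatever `B` does on `ker C`. -/
theorem exists_pos_eigenpair (hB : ∀ u v, B u v = B v u) (hC : ∀ u v, C u v = C v u)
    (hC0 : ∀ v, 0 ≤ C v v) (W : Submodule ℝ E)
    (hW : Module.finrank ℝ (LinearMap.ker C) < Module.finrank ℝ W)
    (hWpos : ∀ w ∈ W, w ≠ 0 → 0 < B w w) :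
    ∃ (lam : ℝ) (p : E), 0 < lam ∧ 0 < C p p ∧ ∀ v, B p v = lam * C p v := by
  set Z := LinearMap.ker C with hZ
  have hZ0 : ∀ z ∈ Z, ∀ v, C z v = 0 := fun z hz v => by rw [LinearMap.mem_ker.1 hz]; rfl
  have hZ0' : ∀ z ∈ Z, ∀ v, C v z = 0 := fun z hz v => by rw [hC]; exact hZ0 z hz v
  -- `Y` is the `B`-orthogonal complement of `Z`. Presenting it as a coannihilator makes `U` its
  -- annihilator, which later supplies the correction of the eigenvector.
  set U : Submodule ℝ (Module.Dual ℝ E) := Z.map B with hU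
  set Y := U.dualCoannihilator with hY
  have hYm : ∀ y, y ∈ Y ↔ ∀ z ∈ Z, B z y = 0 := by
    intro y
    rw [hY, Submodule.mem_dualCoannihilator]
    simp [hU]
  obtain ⟨w, hwW, hw0, hwY⟩ : ∃ w ∈ W, w ≠ 0 ∧ w ∈ Y := by
    let F : W →ₗ[ℝ] Module.Dual ℝ Z := (Submodule.dualRestrict Z) ∘ₗ B ∘ₗ W.subtype
    have hF : LinearMap.ker F ≠ ⊥ :=
      LinearMap.ker_ne_bot_of_finrank_lt (by rwa [Subspace.dual_finrank_eq])
    obtain ⟨w, hw, hw0⟩ := Submodule.exists_mem_ne_zero_of_ne_bot hF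
    refine ⟨w, w.2, fun h => hw0 (Subtype.ext h), (hYm _).2 fun z hz => ?_⟩
    have := LinearMap.congr_fun (LinearMap.mem_ker.1 hw) ⟨z, hz⟩
    rw [hB]
    simpa [F] using this
  -- `B` may degenerate on `Z`, so `Z ⊓ Y` need not be trivial; `Y ⊓ Q` is a complement of it in
  -- `Y`, and `C` is definite there.
  obtain ⟨Q, hQ⟩ := Submodule.exists_isCompl (Z ⊓ Y)
  have hdec : ∀ y ∈ Y, ∃ z ∈ Z ⊓ Y, ∃ q ∈ Y ⊓ Q, y = z + q := by
    intro y hy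
    obtain ⟨z, hz, q, hq, rfl⟩ := Submodule.mem_sup.1
      (show y ∈ (Z ⊓ Y) ⊔ Q by rw [hQ.sup_eq_top]; trivial)
    refine ⟨z, hz, q, ⟨?_, hq⟩, rfl⟩
    simpa using Y.sub_mem hy hz.2
  let P := Y ⊓ Q
  have hpos : ∀ v : P, v ≠ 0 → 0 < (C.domRestrict₁₂ P P) v v := by
    intro v hv
    refine lt_of_le_of_ne (hC0 v) fun h => hv ?_
    have hvZ : (v : E) ∈ Z := LinearMap.mem_ker.2 (apply_eq_zero_of_apply_self_eq_zero hC hC0 h.symm)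
    have : (v : E) ∈ (Z ⊓ Y) ⊓ Q := ⟨⟨hvZ, v.2.1⟩, v.2.2⟩
    rw [hQ.inf_eq_bot] at this
    exact Subtype.ext this
  obtain ⟨e, lam, -, h1, h2⟩ := exists_basis_diagonal (B := B.domRestrict₁₂ P P)
    (C := C.domRestrict₁₂ P P) (fun u v => hB u v) (fun u v => hC u v) hpos rfl
  -- The `Z ⊓ Y` part of `w` is `B`-orthogonal to `Y`, hence `B q q = B w w > 0` for the remaining
  -- part `q`.
  obtain ⟨i, hi⟩ : ∃ i, 0 < lam i := by
    obtain ⟨z, hz, q, hq, rfl⟩ := hdec w hwY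
    have hBw := hWpos _ hwW hw0
    have e1 : B z z = 0 := (hYm z).1 hz.2 z hz.1
    have e2 : B z q = 0 := (hYm q).1 hq.1 z hz.1
    simp only [map_add, LinearMap.add_apply, e1, e2, hB q z] at hBw
    have := (apply_self_of_basis_diagonal h1 h2 ⟨q, hq⟩).1
    simp only [LinearMap.domRestrict₁₂_apply] at this
    rw [this] at hBw
    by_contra! hle
    have : ∑ i, lam i * (e.repr ⟨q, hq⟩) i ^ 2 ≤ 0 :=
      Finset.sum_nonpos fun i _ => mul_nonpos_of_nonpos_of_nonneg (hle i) (sq_nonneg _)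
    linarith
  -- The residual of the eigenvalue equation annihilates `Y`, so it equals `B z` for some `z ∈ Z`.
  -- Subtracting `z` from `e i` removes it and leaves `C (e i)` unchanged.
  have hf : B (e i) - lam i • C (e i) ∈ U := by
    have hUU : Y.dualAnnihilator = U := Subspace.dualCoannihilator_dualAnnihilator_eq
    rw [← hUU, Submodule.mem_dualAnnihilator]
    intro y hy
    obtain ⟨z, hz, q, hq, rfl⟩ := hdec y hy
    have a1 : B (e i) q = lam i * C (e i) q := h2 i ⟨q, hq⟩
    have a2 : B (e i) z = 0 := by rw [hB]; exact (hYm _).1 (e i).2.1 z hz.1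
    simp [a1, a2, hZ0' z hz.1]
  obtain ⟨z, hz, hzf⟩ := hf
  have hcp : ∀ v, C (e i - z) v = C (e i) v := fun v => by simp [hZ0 z hz]
  refine ⟨lam i, e i - z, hi, ?_, fun v => ?_⟩
  · rw [hcp, map_sub, hZ0' z hz, sub_zero]
    have : C (e i) (e i) = 1 := (h1 i i).trans (if_pos rfl)
    rw [this]; exact one_pos
  · rw [hcp, map_sub, hzf]
    simp

/-- A complete orthonormal system of eigenvectors catches every finite eigenvalue. -/
theorem exists_eq_of_eigensystem (hB : ∀ u v, B u v = B v u) (hC : ∀ u v, C u v = C v u)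
    {lam₀ : ℝ} {p₀ : E} (h₀ : 0 < C p₀ p₀) (hp₀ : ∀ v, B p₀ v = lam₀ * C p₀ v)
    {m : ℕ} (hm : m = Module.finrank ℝ E - Module.finrank ℝ (LinearMap.ker C))
    {lam : Fin m → ℝ} {p : Fin m → E} (hp : ∀ i v, B (p i) v = lam i * C (p i) v)
    (ho : ∀ i j, C (p i) (p j) = if i = j then 1 else 0) : ∃ i, lam i = lam₀ := by
  let F : E →ₗ[ℝ] (Fin m → ℝ) := LinearMap.pi fun i => C (p i)
  have hF : Function.Surjective F := by
    intro a
    refine ⟨∑ i, a i • p i, ?_⟩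
    funext j
    simp [F, ho]
  have hle : LinearMap.ker C ≤ LinearMap.ker F := by
    intro z hz
    rw [LinearMap.mem_ker]
    funext i
    change C (p i) z = 0
    rw [hC, LinearMap.mem_ker.1 hz]; rfl
  -- Orthonormality makes `F` surjective, so its kernel has dimension `dim E - m = dim ker C`.
  have hker : LinearMap.ker C = LinearMap.ker F := by
    refine Submodule.eq_of_le_of_finrank_eq hle ?_
    have h1 := LinearMap.finrank_range_add_finrank_ker F
    rw [LinearMap.range_eq_top.2 hF, finrank_top, Module.finrank_fin_fun] at h1
    have h2 := Submodule.finrank_le (LinearMap.ker C)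
    omega
  obtain ⟨i, hi⟩ : ∃ i, C (p i) p₀ ≠ 0 := by
    by_contra! h
    have : p₀ ∈ LinearMap.ker C := by
      rw [hker, LinearMap.mem_ker]
      funext i; exact h i
    rw [LinearMap.mem_ker.1 this] at h₀
    exact lt_irrefl _ h₀
  refine ⟨i, ?_⟩
  -- Evaluating `B (p i) p₀` from both sides gives `lam i` and `lam₀` times the same nonzero number.
  have h1 := hp i p₀
  rw [hB, hp₀, hC p₀] at h1
  exact (mul_right_cancel₀ hi h1).symm

/-- If `B` is positive definite on `ker C`, the pencil has a complete system of
eigenvectors. -/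
theorem exists_eigensystem (hB : ∀ u v, B u v = B v u) (hC : ∀ u v, C u v = C v u)
    (hC0 : ∀ v, 0 ≤ C v v) (hpos : ∀ z ∈ LinearMap.ker C, z ≠ 0 → 0 < B z z)
    {m : ℕ} (hm : m = Module.finrank ℝ E - Module.finrank ℝ (LinearMap.ker C)) :
    ∃ (lam : Fin m → ℝ) (p : Fin m → E), Monotone lam ∧
      (∀ i v, B (p i) v = lam i * C (p i) v) ∧
      ∀ i j, C (p i) (p j) = if i = j then 1 else 0 := by
  set Z := LinearMap.ker C with hZ
  have hZ0 : ∀ z ∈ Z, ∀ v, C v z = 0 := fun z hz v => by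
    rw [hC, LinearMap.mem_ker.1 hz]; rfl
  let F : E →ₗ[ℝ] Module.Dual ℝ Z := (Submodule.dualRestrict Z) ∘ₗ B
  set Y := LinearMap.ker F with hY
  have hYm : ∀ y, y ∈ Y ↔ ∀ z ∈ Z, B y z = 0 := by
    intro y
    rw [hY, LinearMap.mem_ker]
    constructor
    · intro h z hz
      exact LinearMap.congr_fun h ⟨z, hz⟩
    · intro h; ext z; exact h z z.2
  have hdis : Disjoint Z Y := by
    rw [Submodule.disjoint_def]
    intro z hz hzY
    by_contra h
    exact (hpos z hz h).ne' ((hYm z).1 hzY z hz)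
  -- `F` maps into a space of dimension `dim Z`, so `Y` is at least large enough; disjointness shows
  -- that it is not larger.
  have hdim : Module.finrank ℝ Z + Module.finrank ℝ Y = Module.finrank ℝ E := by
    have h1 : _ + Module.finrank ℝ Y = _ := LinearMap.finrank_range_add_finrank_ker F
    have h2 := Submodule.finrank_le (LinearMap.range F)
    rw [Subspace.dual_finrank_eq] at h2
    have h3 := Submodule.finrank_add_finrank_le_of_disjoint hdis
    omega
  have htop := Submodule.eq_top_of_disjoint Z Y hdim.ge hdis
  have hposY : ∀ v : Y, v ≠ 0 → 0 < (C.domRestrict₁₂ Y Y) v v := by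
    intro v hv
    refine lt_of_le_of_ne (hC0 v) fun h => hv ?_
    exact Subtype.ext ((Submodule.disjoint_def.1 hdis) v
      (LinearMap.mem_ker.2 (apply_eq_zero_of_apply_self_eq_zero hC hC0 h.symm)) v.2)
  obtain ⟨e, lam, hmono, h1, h2⟩ := exists_basis_diagonal (B := B.domRestrict₁₂ Y Y)
    (C := C.domRestrict₁₂ Y Y) (fun u v => hB u v) (fun u v => hC u v) hposY
    (m := m) (by omega)
  refine ⟨lam, fun i => e i, hmono, fun i v => ?_, fun i j => h1 i j⟩
  obtain ⟨z, hz, y, hy, rfl⟩ := Submodule.mem_sup.1 (show v ∈ Z ⊔ Y by rw [htop]; trivial)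
  have a1 : B (e i) y = lam i * C (e i) y := h2 i ⟨y, hy⟩
  have a2 : B (e i) z = 0 := (hYm _).1 (e i).2 z hz
  simp [a1, a2, hZ0 z hz]

end Pencil

/-! ### Hat functions -/

section Hat

variable {d : ℕ} {K : Mesh d}

theorem IsBary.hat_eq {x : Pt d} {w : Pt d → ℝ} (h : IsBary K x w) (v : Pt d) :
    hat K v x = w v := by
  have hex : ∃ w, IsBary K x w := ⟨w, h⟩
  rw [hat, dif_pos hex, IsBary.unique hex.choose_spec h]

/-- Uniqueness of barycentric coordinates lets any simplex containing `x`, not just the smallest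
one, be used to compute the hat functions. -/
theorem isBary_hat {s : Finset (Pt d)} (hs : s ∈ K.faces) {x : Pt d}
    (hx : x ∈ convexHull ℝ (s : Set (Pt d))) :
    (∀ v, 0 ≤ hat K v x) ∧ (∀ v, v ∉ s → hat K v x = 0) ∧ ∑ v ∈ s, hat K v x = 1 ∧
      ∑ v ∈ s, hat K v x • v = x := by
  classical
  rw [Finset.mem_convexHull'] at hx
  obtain ⟨w, h0, h1, h2⟩ := hx
  have hb : IsBary K x (fun v => if v ∈ s then w v else 0) := by
    refine ⟨s, hs, fun v hv => by simpa [hv] using h0 v hv, fun v hv => by simp [hv], ?_, ?_⟩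
    · rw [← h1]; exact Finset.sum_congr rfl fun v hv => by simp [hv]
    · rw [← h2]; exact Finset.sum_congr rfl fun v hv => by simp [hv]
  simp only [hb.hat_eq]
  refine ⟨fun v => ?_, fun v hv => by simp [hv], ?_, ?_⟩
  · split_ifs with hv
    · exact h0 v hv
    · exact le_rfl
  · rw [← h1]; exact Finset.sum_congr rfl fun v hv => by simp [hv]
  · rw [← h2]; exact Finset.sum_congr rfl fun v hv => by simp [hv]

theorem hat_of_notMem_space {x : Pt d} (hx : x ∉ K.space) (v : Pt d) : hat K v x = 0 := by
  rw [hat, dif_neg]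
  rintro ⟨w, s, hs, h0, -, h1, h2⟩
  refine hx (Geometry.SimplicialComplex.mem_space_iff.2 ⟨s, hs, ?_⟩)
  rw [Finset.mem_convexHull']
  exact ⟨w, h0, h1, h2⟩

/-- A point of the mesh lies in every simplex that contains its carrier. -/
theorem mem_convexHull_of_hat {x : Pt d} (hx : x ∈ K.space) {t : Finset (Pt d)}
    (h : ∀ v, v ∉ t → hat K v x = 0) : x ∈ convexHull ℝ (t : Set (Pt d)) := by
  classical
  obtain ⟨s, hs, hxs⟩ := Geometry.SimplicialComplex.mem_space_iff.1 hx
  obtain ⟨h0, h1, h2, h3⟩ := isBary_hat hs hxs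
  rw [Finset.mem_convexHull']
  have key : ∀ {M : Type} [AddCommMonoid M] (g : Pt d → M), (∀ v, hat K v x = 0 → g v = 0) →
      ∑ v ∈ t, g v = ∑ v ∈ s, g v := by
    intro M _ g hg
    rw [← Finset.sum_subset (Finset.inter_subset_left : s ∩ t ⊆ s),
      ← Finset.sum_subset (Finset.inter_subset_right : s ∩ t ⊆ t)]
    · intro v hv hv'
      exact hg v (h1 v fun hvs => hv' (Finset.mem_inter.2 ⟨hvs, hv⟩))
    · intro v hv hv'
      exact hg v (h v fun hvt => hv' (Finset.mem_inter.2 ⟨hv, hvt⟩))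
  exact ⟨fun v => hat K v x, fun v _ => h0 v, by rw [key _ fun v hv => hv, h2],
    by rw [key (fun v => hat K v x • v) fun v hv => by rw [hv, zero_smul], h3]⟩

theorem hat_convexComb {s : Finset (Pt d)} (hs : s ∈ K.faces) {x y : Pt d}
    (hx : x ∈ convexHull ℝ (s : Set (Pt d))) (hy : y ∈ convexHull ℝ (s : Set (Pt d)))
    {a b : ℝ} (ha : 0 ≤ a) (hb : 0 ≤ b) (hab : a + b = 1) (v : Pt d) :
    hat K v (a • y + b • x) = a * hat K v y + b * hat K v x := by
  obtain ⟨x0, x1, x2, x3⟩ := isBary_hat hs hx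
  obtain ⟨y0, y1, y2, y3⟩ := isBary_hat hs hy
  have : IsBary K (a • y + b • x) (fun v => a * hat K v y + b * hat K v x) := by
    refine ⟨s, hs, fun v _ => add_nonneg (mul_nonneg ha (y0 v)) (mul_nonneg hb (x0 v)),
      fun v hv => by simp [x1 v hv, y1 v hv], ?_, ?_⟩
    · rw [Finset.sum_add_distrib, ← Finset.mul_sum, ← Finset.mul_sum, x2, y2]; linarith
    · simp only [add_smul, mul_smul, Finset.sum_add_distrib, ← Finset.smul_sum, x3, y3]
  exact this.hat_eq v

/-- On an element the hat functions are restrictions of affine functions, the barycentric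
coordinates of the element. -/
theorem exists_barycentric {T : Finset (Pt d)} (hT : T ∈ elements K) :
    ∃ L : Pt d → (Pt d →ᵃ[ℝ] ℝ), (∀ x, (∀ v, 0 ≤ L v x) → x ∈ convexHull ℝ (T : Set (Pt d))) ∧
      (∀ v, v ∉ T → L v = 0) ∧
      ∀ x ∈ convexHull ℝ (T : Set (Pt d)), ∀ v, hat K v x = L v x := by
  classical
  have hi := K.indep hT.1
  have htop : affineSpan ℝ (Set.range ((↑) : T → Pt d)) = ⊤ := by
    rw [hi.affineSpan_eq_top_iff_card_eq_finrank_add_one]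
    simp [hT.2]
  let b : AffineBasis T ℝ (Pt d) := ⟨(↑), hi, htop⟩
  have hb : convexHull ℝ (T : Set (Pt d)) = {x | ∀ i, 0 ≤ b.coord i x} := by
    rw [← b.convexHull_eq_nonneg_coord]
    congr 1
    change _ = Set.range ((↑) : T → Pt d)
    simp
  let L : Pt d → (Pt d →ᵃ[ℝ] ℝ) := fun v => if h : v ∈ T then b.coord ⟨v, h⟩ else 0
  have hL : ∀ v : T, L v = b.coord v := fun v => by simp [L]
  refine ⟨L, fun x hx => ?_, fun v hv => by simp [L, hv], fun x hx v => ?_⟩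
  · rw [hb]; intro i; rw [← hL]; exact hx i
  · refine IsBary.hat_eq (w := fun v => L v x) ⟨T, hT.1, fun v hv => ?_, fun v hv => by
      simp [L, hv], ?_, ?_⟩ v
    · rw [hb] at hx; have := hx ⟨v, hv⟩; rwa [← hL] at this
    · rw [← Finset.sum_coe_sort, ← b.sum_coord_apply_eq_one x]
      exact Finset.sum_congr rfl fun v _ => by rw [hL]
    · rw [← Finset.sum_coe_sort T (fun v => L v x • v)]
      conv_rhs => rw [← b.linear_combination_coord_eq_self x]
      exact Finset.sum_congr rfl fun v _ => by rw [hL]; rfl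

theorem exists_polyFun_affineMap (f : Pt d →ᵃ[ℝ] ℝ) :
    ∃ p : MvPolynomial (Fin d) ℝ, p.totalDegree ≤ 1 ∧ ∀ x, f x = polyFun p x := by
  refine ⟨MvPolynomial.C (f 0) + ∑ i, MvPolynomial.C (f.linear (EuclideanSpace.single i 1)) *
    MvPolynomial.X i, ?_, fun x => ?_⟩
  · refine (MvPolynomial.totalDegree_add _ _).trans (max_le (by simp) ?_)
    refine MvPolynomial.totalDegree_finsetSum_le fun i _ => ?_
    refine (MvPolynomial.totalDegree_mul _ _).trans ?_
    simp
  · have hx : x = ∑ i, x i • EuclideanSpace.single i (1 : ℝ) := by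
      ext j; simp [Pi.single_apply]
    have h1 := congrFun (AffineMap.decomp f) x
    simp only [Pi.add_apply] at h1
    rw [h1, add_comm]
    simp only [polyFun, map_add, MvPolynomial.eval_C, map_sum, map_mul, MvPolynomial.eval_X]
    congr 1
    conv_lhs => rw [hx, map_sum]
    exact Finset.sum_congr rfl fun i _ => by simp [mul_comm]

theorem exists_polyFun_hat {T : Finset (Pt d)} (hT : T ∈ elements K) (v : Pt d) :
    ∃ p : MvPolynomial (Fin d) ℝ, p.totalDegree ≤ 1 ∧
      ∀ x ∈ convexHull ℝ (T : Set (Pt d)), hat K v x = polyFun p x := by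
  obtain ⟨L, -, -, hL⟩ := exists_barycentric hT
  obtain ⟨p, hp, hpe⟩ := exists_polyFun_affineMap (L v)
  exact ⟨p, hp, fun x hx => by rw [hL x hx, hpe]⟩

end Hat

/-! ### Meshes -/

section Mesh

variable {d : ℕ} {K : Mesh d} {Ω : Set (Pt d)}

theorem isCompact_element (T : Finset (Pt d)) : IsCompact (convexHull ℝ (T : Set (Pt d))) :=
  T.finite_toSet.isCompact_convexHull ℝ

theorem IsMeshOf.finite_elements (hK : IsMeshOf K Ω) : (elements K).Finite :=
  hK.finite.subset fun _ h => h.1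

theorem IsMeshOf.space_eq (hK : IsMeshOf K Ω) :
    K.space = ⋃ T ∈ elements K, convexHull ℝ (T : Set (Pt d)) := by
  ext x
  rw [Geometry.SimplicialComplex.mem_space_iff]
  simp only [mem_iUnion, exists_prop]
  constructor
  · rintro ⟨s, hs, hx⟩
    obtain ⟨T, hT, hsT⟩ := hK.pure s hs
    exact ⟨T, hT, convexHull_mono (Finset.coe_subset.2 hsT) hx⟩
  · rintro ⟨T, hT, hx⟩
    exact ⟨T, hT.1, hx⟩

theorem isClosed_biUnion_elements {S : Set (Finset (Pt d))} (hS : S.Finite) :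
    IsClosed (⋃ T ∈ S, convexHull ℝ (T : Set (Pt d))) :=
  hS.isClosed_biUnion fun T _ => (isCompact_element T).isClosed

theorem IsMeshOf.isClosed_space (hK : IsMeshOf K Ω) : IsClosed K.space := by
  rw [hK.space_eq]; exact isClosed_biUnion_elements hK.finite_elements

theorem IsMeshOf.isOpen (hK : IsMeshOf K Ω) : IsOpen Ω := by
  rw [hK.domain]; exact isOpen_interior

theorem continuousOn_biUnion_elements {S : Set (Finset (Pt d))} (hS : S.Finite) {f : Pt d → ℝ}
    (hf : ∀ T ∈ S, ContinuousOn f (convexHull ℝ (T : Set (Pt d)))) :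
    ContinuousOn f (⋃ T ∈ S, convexHull ℝ (T : Set (Pt d))) := by
  rw [biUnion_eq_iUnion]
  have := hS.to_subtype
  exact (locallyFinite_of_finite _).continuousOn_iUnion
    (fun T => (isCompact_element T.1).isClosed) fun T => hf T T.2

theorem interior_element_nonempty {T : Finset (Pt d)} (hT : T ∈ elements K) :
    (interior (convexHull ℝ (T : Set (Pt d)))).Nonempty := by
  rw [interior_convexHull_nonempty_iff_affineSpan_eq_top]
  have := (K.indep hT.1).affineSpan_eq_top_iff_card_eq_finrank_add_one.2 (by simp [hT.2])
  simpa using this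

end Mesh

/-! ### The nodal basis -/

section Nodal

variable {d r : ℕ} {K : Mesh d} {Ω : Set (Pt d)}

theorem phi_eq_zero {α : Pt d →₀ ℕ} {v x : Pt d} (hv : v ∈ α.support) (h : hat K v x = 0) :
    phi K r α x = 0 :=
  Finset.prod_eq_zero hv (Finset.prod_eq_zero
    (Finset.mem_range.2 (Nat.pos_of_ne_zero (Finsupp.mem_support_iff.1 hv))) (by simp [h]))

theorem support_nonempty {α : Pt d →₀ ℕ} (hα : α ∈ dofs K r Ω) : α.support.Nonempty :=
  Geometry.SimplicialComplex.nonempty_of_mem_faces hα.1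

theorem node_mem_convexHull (hr : 1 ≤ r) {α : Pt d →₀ ℕ} (hα : α ∈ dofs K r Ω) :
    node r α ∈ convexHull ℝ (α.support : Set (Pt d)) := by
  rw [Finset.mem_convexHull']
  refine ⟨fun v => (α v : ℝ) / r, fun _ _ => by positivity, ?_, rfl⟩
  have := hα.2.1
  simp only [Finsupp.sum] at this
  rw [← Finset.sum_div, ← Nat.cast_sum, this, div_self (by positivity)]

open Filter Topology in
/-- A nodal basis function only lives in the interior of the mesh. -/
theorem mem_of_phi_ne_zero (hK : IsMeshOf K Ω) (hr : 1 ≤ r) {α : Pt d →₀ ℕ}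
    (hα : α ∈ dofs K r Ω) {x : Pt d} (hx : phi K r α x ≠ 0) : x ∈ Ω := by
  have hne : ∀ v ∈ α.support, hat K v x ≠ 0 := fun v hv h => hx (phi_eq_zero hv h)
  have hxK : x ∈ K.space := by
    by_contra h
    obtain ⟨v, hv⟩ := support_nonempty hα
    exact hne v hv (hat_of_notMem_space h v)
  obtain ⟨s, hs, hxs⟩ := Geometry.SimplicialComplex.mem_space_iff.1 hxK
  obtain ⟨x0, x1, -, -⟩ := isBary_hat hs hxs
  have hsub : α.support ⊆ s := fun v hv => by
    by_contra h; exact hne v hv (x1 v h)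
  have hpos : ∀ v ∈ α.support, 0 < hat K v x := fun v hv => lt_of_le_of_ne (x0 v) (hne v hv).symm
  set y := node r α with hy
  have hyα := node_mem_convexHull hr hα
  have hys : y ∈ convexHull ℝ (s : Set (Pt d)) := convexHull_mono (Finset.coe_subset.2 hsub) hyα
  obtain ⟨y0, y1, -, -⟩ := isBary_hat hα.1 hyα
  have hyΩ : y ∈ interior K.space := by rw [← hK.domain]; exact hα.2.2
  -- Contracting towards the node `y`, which is interior, brings a neighbourhood of `x` into the
  -- mesh. It remains to pull membership in an element back through the contraction.
  obtain ⟨t, ht0, ht1, hz⟩ : ∃ t : ℝ, 0 < t ∧ t < 1 ∧ (1 - t) • y + t • x ∈ interior K.space := by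
    have hc : Continuous fun t : ℝ => (1 - t) • y + t • x := by fun_prop
    have h1 : ∀ᶠ t in 𝓝 (0 : ℝ), (1 - t) • y + t • x ∈ interior K.space :=
      hc.continuousAt.eventually_mem (isOpen_interior.mem_nhds (by simpa using hyΩ))
    have h2 : ∀ᶠ t in 𝓝[>] (0 : ℝ), 0 < t ∧ t < 1 :=
      Ioo_mem_nhdsGT one_pos
    obtain ⟨t, h3, h4⟩ := (h2.and (h1.filter_mono nhdsWithin_le_nhds)).exists
    exact ⟨t, h3.1, h3.2, h4⟩
  have hc : Continuous fun x' : Pt d => (1 - t) • y + t • x' := by fun_prop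
  have hnear : ∀ᶠ x' in 𝓝 x, (1 - t) • y + t • x' ∈ K.space :=
    (hc.continuousAt.eventually_mem (isOpen_interior.mem_nhds hz)).mono
      fun _ h => interior_subset h
  have hall : ∀ T ∈ elements K, ∀ᶠ x' in 𝓝 x,
      (1 - t) • y + t • x' ∈ convexHull ℝ (T : Set (Pt d)) →
        x' ∈ convexHull ℝ (T : Set (Pt d)) := by
    intro T hT
    -- If the contracted point lies in `T`, then so do `x` and `y`. For `x'` near `x`, coordinates
    -- in `α.support` stay positive by continuity; the others vanish at `y`, so the contraction only
    -- scales them by `t` and preserves their sign. If it does not lie in `T`, nearby contracted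
    -- points avoid `T` as well.
    by_cases hzT : (1 - t) • y + t • x ∈ convexHull ℝ (T : Set (Pt d))
    · obtain ⟨-, z1, -, -⟩ := isBary_hat hT.1 hzT
      have hxz : ∀ v, v ∉ T → hat K v x = 0 := by
        intro v hv
        have h1 := z1 v hv
        have h2 := hat_convexComb hs hxs hys (sub_nonneg.2 ht1.le) ht0.le (by ring) v
        have h3 := mul_nonneg (sub_nonneg.2 ht1.le) (y0 v)
        have h4 := x0 v
        by_contra hne
        have := mul_pos ht0 (lt_of_le_of_ne h4 (Ne.symm hne))
        linarith
      have hxT := mem_convexHull_of_hat hxK hxz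
      have hαT : α.support ⊆ T := fun v hv => by
        by_contra h; exact hne v hv (hxz v h)
      have hyT : y ∈ convexHull ℝ (T : Set (Pt d)) :=
        convexHull_mono (Finset.coe_subset.2 hαT) hyα
      obtain ⟨L, hL1, hL2, hL3⟩ := exists_barycentric hT
      have hev : ∀ᶠ x' in 𝓝 x, ∀ v ∈ α.support, 0 < L v x' := by
        rw [Filter.eventually_all_finset]
        intro v hv
        refine (L v).continuous_of_finiteDimensional.continuousAt.eventually_const_lt ?_
        rw [← hL3 x hxT]; exact hpos v hv
      filter_upwards [hev] with x' hx' hzx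
      refine hL1 x' fun v => ?_
      by_cases hv : v ∈ α.support
      · exact (hx' v hv).le
      · have h1 : L v y = 0 := by rw [← hL3 y hyT]; exact y1 v hv
        have h2 : 0 ≤ L v ((1 - t) • y + t • x') := by
          rw [← hL3 _ hzx]; exact (isBary_hat hT.1 hzx).1 v
        have h3 : L v ((1 - t) • y + t • x') = (1 - t) * L v y + t * L v x' :=
          Convex.combo_affine_apply (by ring)
        rw [h3, h1, mul_zero, zero_add] at h2
        exact nonneg_of_mul_nonneg_right h2 ht0
    · exact (hc.continuousAt.eventually_mem
        ((isCompact_element T).isClosed.isOpen_compl.mem_nhds hzT)).mono fun x' h h' =>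
          absurd h' h
  rw [hK.domain, mem_interior_iff_mem_nhds]
  have hall' := (Filter.eventually_all_finite hK.finite_elements).2 hall
  filter_upwards [hnear, hall'] with x' h1 h2
  rw [hK.space_eq] at h1 ⊢
  simp only [mem_iUnion] at h1 ⊢
  obtain ⟨T, hT, hxT⟩ := h1
  exact ⟨T, hT, h2 T hT hxT⟩

/-- Each factor is affine on an element, and there are `∑ α v = r` of them. -/
theorem isPolyOn_phi {α : Pt d →₀ ℕ} (hα : α ∈ dofs K r Ω) {T : Finset (Pt d)}
    (hT : T ∈ elements K) : IsPolyOn r (phi K r α) (convexHull ℝ (T : Set (Pt d))) := by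
  choose P hP1 hP2 using exists_polyFun_hat hT
  refine ⟨∏ v ∈ α.support, ∏ j ∈ Finset.range (α v),
    MvPolynomial.C ((α v : ℝ) - j)⁻¹ * (MvPolynomial.C (r : ℝ) * P v - MvPolynomial.C (j : ℝ)),
    ?_, fun x hx => ?_⟩
  · refine (MvPolynomial.totalDegree_finsetProd _ _).trans ?_
    have hsum : ∑ v ∈ α.support, α v = r := hα.2.1
    refine le_trans (Finset.sum_le_sum fun v _ => ?_) hsum.le
    refine (MvPolynomial.totalDegree_finsetProd _ _).trans ?_
    refine (Finset.sum_le_sum (g := fun _ => 1) fun j _ => ?_).trans (by simp)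
    refine (MvPolynomial.totalDegree_mul _ _).trans ?_
    rw [MvPolynomial.totalDegree_C, zero_add]
    refine (MvPolynomial.totalDegree_sub _ _).trans (max_le ?_ (by rw [MvPolynomial.totalDegree_C]; exact zero_le_one))
    refine (MvPolynomial.totalDegree_mul _ _).trans ?_
    rw [MvPolynomial.totalDegree_C, zero_add]
    exact hP1 v
  · simp only [phi, map_prod, map_mul, map_sub, MvPolynomial.eval_C]
    refine Finset.prod_congr rfl fun v _ => Finset.prod_congr rfl fun j _ => ?_
    rw [hP2 v x hx, polyFun, div_eq_inv_mul]

/-- Continuity is pasted from the closed sets `K.space` and `Ωᶜ`, which cover the whole space; the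
zero values off `Ω` come from `mem_of_phi_ne_zero`. -/
theorem phi_mem_Vh (hK : IsMeshOf K Ω) (hr : 1 ≤ r) {α : Pt d →₀ ℕ} (hα : α ∈ dofs K r Ω) :
    phi K r α ∈ Vh K r Ω := by
  have h0 : ∀ x, x ∉ Ω → phi K r α x = 0 := fun x hx => by
    by_contra h; exact hx (mem_of_phi_ne_zero hK hr hα h)
  refine ⟨?_, h0, fun T hT => isPolyOn_phi hα hT⟩
  have h1 : ContinuousOn (phi K r α) K.space := by
    rw [hK.space_eq]
    refine continuousOn_biUnion_elements hK.finite_elements fun T hT => ?_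
    obtain ⟨p, -, hp⟩ := isPolyOn_phi hα hT
    exact (continuous_polyFun p).continuousOn.congr hp
  have h2 : ContinuousOn (phi K r α) Ωᶜ :=
    (continuousOn_const (c := (0 : ℝ))).congr fun x hx => h0 x hx
  have h3 := h1.union_of_isClosed h2 hK.isClosed_space hK.isOpen.isClosed_compl
  rw [← continuousOn_univ]
  refine h3.mono fun x _ => ?_
  by_cases hx : x ∈ Ω
  · left; rw [hK.domain] at hx; exact interior_subset hx
  · right; exact hx

theorem finite_dofs (hK : IsMeshOf K Ω) : (dofs K r Ω).Finite := by
  classical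
  have hfin : (⋃ s ∈ K.faces, (s : Set (Pt d))).Finite :=
    hK.finite.biUnion fun s _ => s.finite_toSet
  refine (Finset.finite_toSet (Finset.finsuppAntidiag hfin.toFinset r)).subset fun α hα => ?_
  have hsub : α.support ⊆ hfin.toFinset := fun v hv => by
    rw [Set.Finite.mem_toFinset]
    exact mem_biUnion hα.1 hv
  rw [Finset.mem_coe, Finset.mem_finsuppAntidiag]
  refine ⟨?_, hsub⟩
  have := hα.2.1
  rw [Finsupp.sum] at this
  rw [← this]
  exact (Finset.sum_subset hsub fun v _ hv => by simpa using hv).symm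

/-- The nodes of the interior degrees of freedom of a subdomain lie in it. -/
theorem node_mem_subdomain (hK : IsMeshOf K Ω) (hr : 1 ≤ r) {Ω' : Set (Pt d)}
    (hΩ' : IsMeshSubdomain K Ω') {α : Pt d →₀ ℕ} (hα : α ∈ dofInt K r Ω Ω') :
    node r α ∈ Ω' := by
  obtain ⟨S, hS, rfl⟩ := hΩ'
  have hcl := isClosed_biUnion_elements (hK.finite_elements.subset hS)
  have hopen : IsOpen (Function.support (phi K r α)) :=
    isOpen_ne_fun (phi_mem_Vh hK hr hα.1).1 continuous_const
  -- The set where `φ` is nonzero is open and lies in the closed union of the elements, hence in its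
  -- interior; it contains the node.
  refine interior_maximal ?_ hopen ?_
  · refine (subset_tsupport _).trans (hα.2.trans ?_)
    exact closure_minimal interior_subset hcl
  · rw [Function.mem_support, phi_node hr hα.1 hα.1, if_pos rfl]
    exact one_ne_zero

/-- The nodal basis functions vanish at a vertex of each element. -/
theorem exists_phi_eq_zero (hd : 1 ≤ d) {α : Pt d →₀ ℕ} (hα : α ∈ dofs K r Ω)
    {T : Finset (Pt d)} (hT : T ∈ elements K) :
    ∃ x ∈ convexHull ℝ (T : Set (Pt d)), phi K r α x = 0 := by
  obtain ⟨w, hw⟩ := support_nonempty hα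
  -- As `d ≥ 1`, an element has a vertex other than `w`, and the hat function of `w` vanishes there.
  obtain ⟨v, hv, hvw⟩ := Finset.exists_mem_ne (s := T) (by have := hT.2; omega) w
  have hf : ({v} : Finset (Pt d)) ∈ K.faces :=
    K.down_closed hT.1 (by simpa using hv) (by simp)
  refine ⟨v, subset_convexHull ℝ _ hv, phi_eq_zero hw ?_⟩
  exact (isBary_hat hf (x := v) (by simp)).2.1 w (by simpa using hvw.symm)

/-- A finite element function is determined by finitely many polynomials. -/
theorem finiteDimensional_Vh (hK : IsMeshOf K Ω) : FiniteDimensional ℝ (Vh K r Ω) := by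
  classical
  have := hK.finite_elements.to_subtype
  by_cases hne : Nonempty (elements K)
  · have hch : ∀ x : Pt d, ∃ T : elements K, x ∈ Ω → x ∈ convexHull ℝ ((T : Finset (Pt d)) : Set (Pt d)) := by
      intro x
      by_cases hx : x ∈ Ω
      · rw [hK.domain] at hx
        have := interior_subset hx
        rw [hK.space_eq] at this
        simp only [mem_iUnion] at this
        obtain ⟨T, hT, hxT⟩ := this
        exact ⟨⟨T, hT⟩, fun _ => hxT⟩
      · exact ⟨Classical.arbitrary _, fun h => absurd h hx⟩
    -- One element is fixed for each point, so a family of polynomials defines a function linearly.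
    -- The range may contain discontinuous functions but is finite-dimensional.
    choose τ hτ using hch
    let F : (elements K → MvPolynomial.restrictTotalDegree (Fin d) ℝ r) →ₗ[ℝ] (Pt d → ℝ) :=
      { toFun := fun p => Ω.indicator fun x => polyFun (p (τ x)).1 x
        map_add' := fun p q => by
          funext x; by_cases hx : x ∈ Ω <;> simp [hx, polyFun]
        map_smul' := fun c p => by
          funext x; by_cases hx : x ∈ Ω <;> simp [hx, polyFun] }
    have hle : Vh K r Ω ≤ LinearMap.range F := by
      rintro v ⟨-, h0, hp⟩
      choose P hP1 hP2 using fun T : elements K => hp T T.2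
      refine ⟨fun T => ⟨P T, (MvPolynomial.mem_restrictTotalDegree _ _ _).2 (hP1 T)⟩, ?_⟩
      funext x
      by_cases hx : x ∈ Ω
      · simp only [F, LinearMap.coe_mk, AddHom.coe_mk, indicator_of_mem hx]
        exact (hP2 (τ x) x (hτ x hx)).symm
      · simp only [F, LinearMap.coe_mk, AddHom.coe_mk, indicator_of_notMem hx, h0 x hx]
    exact Submodule.finiteDimensional_of_le hle
  · have hΩ : ∀ x, x ∉ Ω := by
      intro x hx
      rw [hK.domain] at hx
      have := interior_subset hx
      rw [hK.space_eq] at this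
      simp only [mem_iUnion] at this
      obtain ⟨T, hT, -⟩ := this
      exact hne ⟨⟨T, hT⟩⟩
    have : Vh K r Ω = ⊥ := by
      rw [eq_bot_iff]
      rintro v ⟨-, h0, -⟩
      exact funext fun x => h0 x (hΩ x)
    rw [this]; infer_instance

end Nodal

/-! ### The bilinear forms on functions with bounded gradient -/

section Forms

variable {d : ℕ} {Ω' : Set (Pt d)} {A : Pt d → Matrix (Fin d) (Fin d) ℝ} {n : Pt d → ℝ}
  {amax nmin : ℝ} {u v w : Pt d → ℝ}

/-- The function `u` is bounded and almost everywhere differentiable on `Ω'` with a bounded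
gradient. -/
structure AEBoundedC1 (Ω' : Set (Pt d)) (u : Pt d → ℝ) : Prop where
  measurable : Measurable u
  bound : ∃ M : ℝ, ∀ᵐ x ∂(volume.restrict Ω'),
    DifferentiableAt ℝ u x ∧ |u x| ≤ M ∧ ‖gradient u x‖ ≤ M

theorem measurable_gradient_apply (u : Pt d → ℝ) (i : Fin d) :
    Measurable fun x => (gradient u x).ofLp i := by
  have h1 : Measurable (gradient u) :=
    (InnerProductSpace.toDual ℝ (Pt d)).symm.continuous.measurable.comp (measurable_fderiv ℝ u)
  exact (EuclideanSpace.proj i : Pt d →L[ℝ] ℝ).continuous.measurable.comp h1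

theorem IsCoefficients.mono {Ω : Set (Pt d)} (h : IsCoefficients Ω A n amax nmin)
    (hsub : Ω' ⊆ Ω) : IsCoefficients Ω' A n amax nmin where
  measurable_A i j := (h.measurable_A i j).mono_measure (Measure.restrict_mono_set _ hsub)
  measurable_n := h.measurable_n.mono_measure (Measure.restrict_mono_set _ hsub)
  symm := ae_mono (Measure.restrict_mono_set _ hsub) h.symm
  bounds_A := ae_mono (Measure.restrict_mono_set _ hsub) h.bounds_A
  nmin_pos := h.nmin_pos
  bounds_n := ae_mono (Measure.restrict_mono_set _ hsub) h.bounds_n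

/-- With unit coefficients the forms become the Dirichlet integral and the `L²` product, which thus
inherit integrability and bilinearity. -/
theorem isCoefficients_one (Ω' : Set (Pt d)) :
    IsCoefficients Ω' (fun _ => (1 : Matrix (Fin d) (Fin d) ℝ)) (fun _ => 1) 1 1 where
  measurable_A _ _ := aemeasurable_const
  measurable_n := aemeasurable_const
  symm := Filter.Eventually.of_forall fun _ => Matrix.isSymm_one
  bounds_A := Filter.Eventually.of_forall fun _ ξ => by simp
  nmin_pos := one_pos
  bounds_n := Filter.Eventually.of_forall fun _ => by simp

theorem dotProduct_self_eq_norm_sq (x : Pt d) : x.ofLp ⬝ᵥ x.ofLp = ‖x‖ ^ 2 := by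
  rw [EuclideanSpace.real_norm_sq_eq, dotProduct]
  exact Finset.sum_congr rfl fun i _ => (sq _).symm

theorem mulVec_dotProduct_comm {M : Matrix (Fin d) (Fin d) ℝ} (hM : M.IsSymm)
    (ξ η : Fin d → ℝ) : M.mulVec ξ ⬝ᵥ η = M.mulVec η ⬝ᵥ ξ := by
  rw [dotProduct_comm, Matrix.dotProduct_mulVec, ← Matrix.mulVec_transpose, hM.eq]

/-- Nonnegativity of the quadratic form at `ξ ± η` bounds the mixed term by the diagonal ones. The
absolute value of `a` matters only for `d = 0`, where `a` may be negative. -/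
theorem abs_mulVec_dotProduct_le {M : Matrix (Fin d) (Fin d) ℝ} (hM : M.IsSymm) {a : ℝ}
    (h : ∀ ξ : Fin d → ℝ, ξ ⬝ᵥ ξ ≤ M.mulVec ξ ⬝ᵥ ξ ∧ M.mulVec ξ ⬝ᵥ ξ ≤ a * (ξ ⬝ᵥ ξ))
    (ξ η : Fin d → ℝ) : |M.mulVec ξ ⬝ᵥ η| ≤ |a| * (ξ ⬝ᵥ ξ + η ⬝ᵥ η) := by
  have h0 : ∀ ζ : Fin d → ℝ, 0 ≤ ζ ⬝ᵥ ζ := fun ζ =>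
    Finset.sum_nonneg fun i _ => mul_self_nonneg _
  have hc := mulVec_dotProduct_comm hM ξ η
  have h1 := (h0 _).trans (h (ξ + η)).1
  have h2 := (h0 _).trans (h (ξ - η)).1
  simp only [Matrix.mulVec_add, Matrix.mulVec_sub, add_dotProduct, dotProduct_add, sub_dotProduct,
    dotProduct_sub] at h1 h2
  have h3 := (h ξ).2
  have h4 := (h η).2
  have h5 : a * (ξ ⬝ᵥ ξ) ≤ |a| * (ξ ⬝ᵥ ξ) := mul_le_mul_of_nonneg_right (le_abs_self a) (h0 ξ)
  have h6 : a * (η ⬝ᵥ η) ≤ |a| * (η ⬝ᵥ η) := mul_le_mul_of_nonneg_right (le_abs_self a) (h0 η)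
  have h7 := mul_nonneg (abs_nonneg a) (h0 ξ)
  have h8 := mul_nonneg (abs_nonneg a) (h0 η)
  rw [mul_add, abs_le]
  constructor <;> linarith

theorem integrableOn_aForm (hA : IsCoefficients Ω' A n amax nmin) (hfin : volume Ω' ≠ ⊤)
    (hu : AEBoundedC1 Ω' u) (hv : AEBoundedC1 Ω' v) :
    IntegrableOn (fun x => (A x).mulVec (gradient u x).ofLp ⬝ᵥ (gradient v x).ofLp) Ω' := by
  obtain ⟨M, hM⟩ := hu.bound
  obtain ⟨M', hM'⟩ := hv.bound
  have : IsFiniteMeasure (volume.restrict Ω') := ⟨by simpa using hfin.lt_top⟩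
  refine Integrable.of_bound ?_ (|amax| * (M ^ 2 + M' ^ 2)) ?_
  · refine AEMeasurable.aestronglyMeasurable ?_
    simp only [dotProduct, Matrix.mulVec]
    refine Finset.aemeasurable_fun_sum _ fun i _ => AEMeasurable.mul ?_
      (measurable_gradient_apply v i).aemeasurable
    exact Finset.aemeasurable_fun_sum _ fun j _ =>
      (hA.measurable_A i j).mul (measurable_gradient_apply u j).aemeasurable
  · filter_upwards [hM, hM', hA.symm, hA.bounds_A] with x h1 h2 h3 h4
    rw [Real.norm_eq_abs]
    refine (abs_mulVec_dotProduct_le h3 h4 _ _).trans ?_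
    rw [dotProduct_self_eq_norm_sq, dotProduct_self_eq_norm_sq]
    have := pow_le_pow_left₀ (norm_nonneg _) h1.2.2 2
    have := pow_le_pow_left₀ (norm_nonneg _) h2.2.2 2
    gcongr

theorem integrableOn_nForm (hA : IsCoefficients Ω' A n amax nmin) (hfin : volume Ω' ≠ ⊤)
    (hu : AEBoundedC1 Ω' u) (hv : AEBoundedC1 Ω' v) :
    IntegrableOn (fun x => n x * u x * v x) Ω' := by
  obtain ⟨M, hM⟩ := hu.bound
  obtain ⟨M', hM'⟩ := hv.bound
  have : IsFiniteMeasure (volume.restrict Ω') := ⟨by simpa using hfin.lt_top⟩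
  refine Integrable.of_bound ?_ (1 * M * M') ?_
  · exact ((hA.measurable_n.mul hu.measurable.aemeasurable).mul
      hv.measurable.aemeasurable).aestronglyMeasurable
  · filter_upwards [hM, hM', hA.bounds_n] with x h1 h2 h3
    rw [Real.norm_eq_abs, abs_mul, abs_mul]
    have hn : |n x| ≤ 1 := abs_le.2 ⟨by linarith [hA.nmin_pos], h3.2⟩
    have := (abs_nonneg _).trans h1.2.1
    exact mul_le_mul (mul_le_mul hn h1.2.1 (abs_nonneg _) zero_le_one) h2.2.1 (abs_nonneg _)
      (by positivity)

theorem aForm_comm (hA : IsCoefficients Ω' A n amax nmin) (u v : Pt d → ℝ) :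
    aForm A Ω' u v = aForm A Ω' v u := by
  refine integral_congr_ae ?_
  filter_upwards [hA.symm] with x hx using mulVec_dotProduct_comm hx _ _

theorem nForm_comm (n : Pt d → ℝ) (Ω' : Set (Pt d)) (u v : Pt d → ℝ) :
    nForm n Ω' u v = nForm n Ω' v u := by
  simp only [nForm]
  congr 1
  funext x
  ring

theorem gradient_add_apply {x : Pt d} (hu : DifferentiableAt ℝ u x)
    (hv : DifferentiableAt ℝ v x) : gradient (u + v) x = gradient u x + gradient v x := by
  simp only [gradient]
  rw [fderiv_add hu hv, map_add]

theorem gradient_smul_apply {x : Pt d} (c : ℝ) (hu : DifferentiableAt ℝ u x) :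
    gradient (c • u) x = c • gradient u x := by
  simp only [gradient]
  rw [fderiv_const_smul hu, map_smul]

theorem aForm_add (hA : IsCoefficients Ω' A n amax nmin) (hfin : volume Ω' ≠ ⊤)
    (hu : AEBoundedC1 Ω' u) (hv : AEBoundedC1 Ω' v) (hw : AEBoundedC1 Ω' w) :
    aForm A Ω' (u + v) w = aForm A Ω' u w + aForm A Ω' v w := by
  rw [aForm, aForm, aForm, ← integral_add (integrableOn_aForm hA hfin hu hw)
    (integrableOn_aForm hA hfin hv hw)]
  obtain ⟨M, hM⟩ := hu.bound
  obtain ⟨M', hM'⟩ := hv.bound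
  refine integral_congr_ae ?_
  filter_upwards [hM, hM'] with x h1 h2
  rw [gradient_add_apply h1.1 h2.1, WithLp.ofLp_add, Matrix.mulVec_add, add_dotProduct]

theorem aForm_smul (c : ℝ) (hu : AEBoundedC1 Ω' u) :
    aForm A Ω' (c • u) w = c * aForm A Ω' u w := by
  rw [aForm, aForm, ← integral_const_mul]
  obtain ⟨M, hM⟩ := hu.bound
  refine integral_congr_ae ?_
  filter_upwards [hM] with x h1
  rw [gradient_smul_apply c h1.1, WithLp.ofLp_smul, Matrix.mulVec_smul, smul_dotProduct,
    smul_eq_mul]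

theorem nForm_add (hA : IsCoefficients Ω' A n amax nmin) (hfin : volume Ω' ≠ ⊤)
    (hu : AEBoundedC1 Ω' u) (hv : AEBoundedC1 Ω' v) (hw : AEBoundedC1 Ω' w) :
    nForm n Ω' (u + v) w = nForm n Ω' u w + nForm n Ω' v w := by
  rw [nForm, nForm, nForm, ← integral_add (integrableOn_nForm hA hfin hu hw)
    (integrableOn_nForm hA hfin hv hw)]
  congr 1
  funext x
  simp only [Pi.add_apply]
  ring

theorem nForm_smul (c : ℝ) : nForm n Ω' (c • u) w = c * nForm n Ω' u w := by
  rw [nForm, nForm, ← integral_const_mul]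
  congr 1
  funext x
  simp only [Pi.smul_apply, smul_eq_mul]
  ring

/-- The Dirichlet integral. -/
noncomputable def gradSq (Ω' : Set (Pt d)) (u : Pt d → ℝ) : ℝ := ∫ x in Ω', ‖gradient u x‖ ^ 2

/-- The squared `L²` norm. -/
noncomputable def normSq (Ω' : Set (Pt d)) (u : Pt d → ℝ) : ℝ := ∫ x in Ω', u x ^ 2

theorem gradSq_nonneg : 0 ≤ gradSq Ω' u := integral_nonneg fun _ => sq_nonneg _

theorem normSq_nonneg : 0 ≤ normSq Ω' u := integral_nonneg fun _ => sq_nonneg _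

theorem gradSq_eq_aForm (Ω' : Set (Pt d)) (u : Pt d → ℝ) :
    gradSq Ω' u = aForm (fun _ => 1) Ω' u u := by
  simp only [gradSq, aForm, Matrix.one_mulVec, dotProduct_self_eq_norm_sq]

theorem normSq_eq_nForm (Ω' : Set (Pt d)) (u : Pt d → ℝ) :
    normSq Ω' u = nForm (fun _ => 1) Ω' u u := by
  simp only [normSq, nForm, one_mul, sq]

theorem integrableOn_gradSq (hfin : volume Ω' ≠ ⊤) (hu : AEBoundedC1 Ω' u) :
    IntegrableOn (fun x => ‖gradient u x‖ ^ 2) Ω' := by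
  simpa only [Matrix.one_mulVec, dotProduct_self_eq_norm_sq] using
    integrableOn_aForm (isCoefficients_one Ω') hfin hu hu

theorem integrableOn_normSq (hfin : volume Ω' ≠ ⊤) (hu : AEBoundedC1 Ω' u) :
    IntegrableOn (fun x => u x ^ 2) Ω' := by
  simpa only [one_mul, ← sq] using integrableOn_nForm (isCoefficients_one Ω') hfin hu hu

theorem gradSq_le_aForm (hA : IsCoefficients Ω' A n amax nmin) (hfin : volume Ω' ≠ ⊤)
    (hu : AEBoundedC1 Ω' u) : gradSq Ω' u ≤ aForm A Ω' u u := by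
  refine integral_mono_ae (integrableOn_gradSq hfin hu) (integrableOn_aForm hA hfin hu hu) ?_
  filter_upwards [hA.bounds_A] with x hx
  rw [← dotProduct_self_eq_norm_sq]
  exact (hx _).1

theorem nForm_le_normSq (hA : IsCoefficients Ω' A n amax nmin) (hfin : volume Ω' ≠ ⊤)
    (hu : AEBoundedC1 Ω' u) : nForm n Ω' u u ≤ normSq Ω' u := by
  refine integral_mono_ae (integrableOn_nForm hA hfin hu hu) (integrableOn_normSq hfin hu) ?_
  filter_upwards [hA.bounds_n] with x hx
  nlinarith [sq_nonneg (u x)]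

theorem mul_normSq_le_nForm (hA : IsCoefficients Ω' A n amax nmin) (hfin : volume Ω' ≠ ⊤)
    (hu : AEBoundedC1 Ω' u) : nmin * normSq Ω' u ≤ nForm n Ω' u u := by
  rw [normSq, ← integral_const_mul]
  refine integral_mono_ae ((integrableOn_normSq hfin hu).const_mul _)
    (integrableOn_nForm hA hfin hu hu) ?_
  filter_upwards [hA.bounds_n] with x hx
  nlinarith [sq_nonneg (u x)]

/-- The forms are bilinear on spaces of functions with bounded gradient. -/
theorem exists_bilinear_aForm_nForm (hA : IsCoefficients Ω' A n amax nmin)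
    (hfin : volume Ω' ≠ ⊤) {V : Submodule ℝ (Pt d → ℝ)} (hV : ∀ u ∈ V, AEBoundedC1 Ω' u) :
    ∃ a m : V →ₗ[ℝ] V →ₗ[ℝ] ℝ, (∀ u v, a u v = aForm A Ω' u v) ∧
      ∀ u v, m u v = nForm n Ω' u v := by
  refine ⟨LinearMap.mk₂ ℝ (fun u v => aForm A Ω' u v) ?_ ?_ ?_ ?_,
    LinearMap.mk₂ ℝ (fun u v => nForm n Ω' u v) ?_ ?_ ?_ ?_, fun _ _ => rfl, fun _ _ => rfl⟩
  · exact fun u v w => aForm_add hA hfin (hV _ u.2) (hV _ v.2) (hV _ w.2)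
  · exact fun c u w => aForm_smul c (hV _ u.2)
  · intro u v w
    rw [aForm_comm hA, aForm_comm hA (u : Pt d → ℝ), aForm_comm hA (u : Pt d → ℝ)]
    exact aForm_add hA hfin (hV _ v.2) (hV _ w.2) (hV _ u.2)
  · intro c u w
    rw [aForm_comm hA, aForm_comm hA (u : Pt d → ℝ)]
    exact aForm_smul c (hV _ w.2)
  · exact fun u v w => nForm_add hA hfin (hV _ u.2) (hV _ v.2) (hV _ w.2)
  · exact fun c u w => nForm_smul c
  · intro u v w
    rw [nForm_comm, nForm_comm _ _ (u : Pt d → ℝ), nForm_comm _ _ (u : Pt d → ℝ)]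
    exact nForm_add hA hfin (hV _ v.2) (hV _ w.2) (hV _ u.2)
  · intro c u w
    rw [nForm_comm, nForm_comm _ _ (u : Pt d → ℝ)]
    exact nForm_smul c

/-- Off its closed support a function vanishes together with its gradient, so both integrands are
zero almost everywhere. -/
theorem forms_eq_zero_of_tsupport (h : volume (tsupport u ∩ tsupport v) = 0) :
    aForm A Ω' u v = 0 ∧ nForm n Ω' u v = 0 := by
  have hae : ∀ᵐ x ∂(volume.restrict Ω'), x ∉ tsupport u ∨ x ∉ tsupport v := by
    refine ae_restrict_of_ae ?_
    rw [ae_iff]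
    convert! h using 2
    ext x
    simp [not_or]
  have hg : ∀ (f : Pt d → ℝ) x, x ∉ tsupport f → gradient f x = 0 := by
    intro f x hx
    have : fderiv ℝ f x = 0 := by
      by_contra hne
      exact hx (support_fderiv_subset ℝ hne)
    rw [gradient, this, map_zero]
  constructor
  · refine integral_eq_zero_of_ae ?_
    filter_upwards [hae] with x hx
    rcases hx with hx | hx <;> simp [hg _ x hx]
  · refine integral_eq_zero_of_ae ?_
    filter_upwards [hae] with x hx
    rcases hx with hx | hx <;> simp [image_eq_zero_of_notMem_tsupport hx]

end Forms

/-! ### Finite element functions on subdomains -/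

section Subdomain

variable {d r : ℕ} {K : Mesh d} {Ω : Set (Pt d)} {S : Set (Finset (Pt d))}

/-- The interior of the union of the closed elements in `S`. -/
def subdomain (S : Set (Finset (Pt d))) : Set (Pt d) :=
  interior (⋃ T ∈ S, convexHull ℝ (T : Set (Pt d)))

theorem isOpen_subdomain (S : Set (Finset (Pt d))) : IsOpen (subdomain S) := isOpen_interior

theorem interior_subset_subdomain {T : Finset (Pt d)} (hT : T ∈ S) :
    interior (convexHull ℝ (T : Set (Pt d))) ⊆ subdomain S :=
  interior_mono (subset_biUnion_of_mem (u := fun T : Finset (Pt d) =>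
    convexHull ℝ (T : Set (Pt d))) hT)

theorem interior_element_ae_eq (T : Finset (Pt d)) :
    (interior (convexHull ℝ (T : Set (Pt d))) : Set (Pt d)) =ᵐ[volume]
      convexHull ℝ (T : Set (Pt d)) :=
  interior_ae_eq_of_null_frontier ((convex_convexHull ℝ _).addHaar_frontier volume)

/-- The subdomain lies between the unions of the open and of the closed elements, which differ by
null frontiers. Integrals thereby split over open elements, where gradients are classical. -/
theorem subdomain_ae_eq (hS : S.Finite) : (subdomain S : Set (Pt d)) =ᵐ[volume]
    (⋃ T ∈ S, interior (convexHull ℝ (T : Set (Pt d))) : Set (Pt d)) := by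
  have h : (⋃ T ∈ S, interior (convexHull ℝ (T : Set (Pt d))) : Set (Pt d)) =ᵐ[volume]
      (⋃ T ∈ S, convexHull ℝ (T : Set (Pt d)) : Set (Pt d)) :=
    Filter.EventuallyEq.countable_bUnion hS.countable fun T _ => interior_element_ae_eq T
  refine Filter.EventuallyLE.antisymm ?_ ?_
  · exact (LE.le.eventuallyLE interior_subset).trans h.symm.le
  · exact LE.le.eventuallyLE (iUnion₂_subset fun T hT => interior_subset_subdomain hT)

theorem volume_subdomain_ne_top (hS : S.Finite) : volume (subdomain S) ≠ ⊤ :=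
  ((measure_mono interior_subset).trans_lt
    (hS.isCompact_biUnion fun T _ => isCompact_element T).measure_lt_top).ne

/-- Overlapping interiors would give the common face nonempty interior, hence `d + 1` vertices, so
it would equal both elements. -/
theorem disjoint_interior_elements {T T' : Finset (Pt d)} (hT : T ∈ elements K)
    (hT' : T' ∈ elements K) (hne : T ≠ T') :
    Disjoint (interior (convexHull ℝ (T : Set (Pt d))))
      (interior (convexHull ℝ (T' : Set (Pt d)))) := by
  classical
  rw [Set.disjoint_iff_inter_eq_empty, ← interior_inter]
  by_contra h
  have hsub := K.inter_subset_convexHull hT.1 hT'.1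
  rw [← Finset.coe_inter] at hsub
  have h1 := (Set.nonempty_iff_ne_empty.2 h).mono (interior_mono hsub)
  have hn : (T ∩ T').Nonempty := by
    have := h1.mono interior_subset
    rw [convexHull_nonempty_iff] at this
    exact_mod_cast this
  have hf := K.down_closed hT.1 Finset.inter_subset_left hn
  rw [interior_convexHull_nonempty_iff_affineSpan_eq_top] at h1
  have hrange : Set.range ((↑) : ↥(T ∩ T') → Pt d) = ↑(T ∩ T') := Subtype.range_coe
  have h2 := (K.indep hf).affineSpan_eq_top_iff_card_eq_finrank_add_one.1 (by rw [hrange, h1])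
  simp only [Fintype.card_coe, finrank_euclideanSpace, Fintype.card_fin] at h2
  have h3 := Finset.eq_of_subset_of_card_le (Finset.inter_subset_left : T ∩ T' ⊆ T)
    (by rw [h2, hT.2])
  have h4 := Finset.eq_of_subset_of_card_le (Finset.inter_subset_right : T ∩ T' ⊆ T')
    (by rw [h2, hT'.2])
  exact hne (h3.symm.trans h4)

theorem integral_subdomain (hK : IsMeshOf K Ω) (hS : S ⊆ elements K) {f : Pt d → ℝ}
    (hf : IntegrableOn f (subdomain S)) :
    ∫ x in subdomain S, f x = ∑ T ∈ (hK.finite_elements.subset hS).toFinset,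
      ∫ x in interior (convexHull ℝ (T : Set (Pt d))), f x := by
  have hSf := hK.finite_elements.subset hS
  rw [setIntegral_congr_set (subdomain_ae_eq hSf)]
  have : (⋃ T ∈ S, interior (convexHull ℝ (T : Set (Pt d)))) =
      ⋃ T ∈ hSf.toFinset, interior (convexHull ℝ (T : Set (Pt d))) := by simp
  rw [this]
  refine integral_biUnion_finset _ (fun T _ => isOpen_interior.measurableSet) ?_ ?_
  · intro T hT T' hT' hne
    exact disjoint_interior_elements (hS (by simpa using hT)) (hS (by simpa using hT')) hne
  · intro T hT
    exact hf.mono_set (interior_subset_subdomain (by simpa using hT))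

/-- On the elements of the subdomain, finite element functions are polynomials. -/
theorem exists_polyFun_of_mem_Vh {v : Pt d → ℝ} (hv : v ∈ Vh K r Ω) (hS : S ⊆ elements K)
    {T : Finset (Pt d)} (hT : T ∈ S) :
    ∃ p : MvPolynomial (Fin d) ℝ, p.totalDegree ≤ r ∧
      (∀ x ∈ convexHull ℝ (T : Set (Pt d)), v x = polyFun p x) ∧
      ∀ x ∈ interior (convexHull ℝ (T : Set (Pt d))),
        restr (subdomain S) v x = polyFun p x ∧
          HasGradientAt (restr (subdomain S) v) (polyGrad p x) x := by
  obtain ⟨p, hp, hpe⟩ := hv.2.2 T (hS hT)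
  have heq : ∀ x ∈ interior (convexHull ℝ (T : Set (Pt d))),
      restr (subdomain S) v x = polyFun p x := fun x hx =>
    (indicator_of_mem (interior_subset_subdomain hT hx) v).trans (hpe x (interior_subset hx))
  refine ⟨p, hp, hpe, fun x hx => ⟨heq x hx, ?_⟩⟩
  refine (hasGradientAt_polyFun p x).congr_of_eventuallyEq ?_
  filter_upwards [isOpen_interior.mem_nhds hx] with y hy using heq y hy

/-- The bounds come from finitely many polynomials on compact elements; the exceptional null set is
the mesh skeleton. -/
theorem aeBoundedC1_restr (hK : IsMeshOf K Ω) (hS : S ⊆ elements K) {v : Pt d → ℝ}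
    (hv : v ∈ Vh K r Ω) : AEBoundedC1 (subdomain S) (restr (subdomain S) v) := by
  have hSf := hK.finite_elements.subset hS
  refine ⟨hv.1.measurable.indicator (isOpen_subdomain S).measurableSet, ?_⟩
  choose! P hP1 hP2 hP3 using fun T (hT : T ∈ S) => exists_polyFun_of_mem_Vh hv hS hT
  have hb : ∀ T : Finset (Pt d), ∃ M : ℝ, ∀ x ∈ convexHull ℝ (T : Set (Pt d)),
      |polyFun (P T) x| + ‖polyGrad (P T) x‖ ≤ M := by
    intro T
    obtain ⟨M, hM⟩ := ((isCompact_element T).image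
      ((continuous_polyFun (P T)).abs.add (continuous_polyGrad (P T)).norm)).bddAbove
    exact ⟨M, fun x hx => hM ⟨x, hx, rfl⟩⟩
  choose M hM using hb
  obtain ⟨M', hM'⟩ := (hSf.image M).bddAbove
  refine ⟨M', ?_⟩
  rw [Measure.restrict_congr_set (subdomain_ae_eq hSf),
    ae_restrict_iff' (hSf.measurableSet_biUnion fun _ _ => isOpen_interior.measurableSet)]
  refine Filter.Eventually.of_forall fun x hx => ?_
  simp only [mem_iUnion] at hx
  obtain ⟨T, hT, hx⟩ := hx
  obtain ⟨h1, h2⟩ := hP3 T hT x hx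
  have h3 := (hM T x (interior_subset hx)).trans (hM' ⟨T, hT, rfl⟩)
  rw [h2.gradient, h1]
  exact ⟨h2.hasFDerivAt.differentiableAt, by linarith [norm_nonneg (polyGrad (P T) x)],
    by linarith [abs_nonneg (polyFun (P T) x)]⟩

theorem aeBoundedC1_of_mem_Vtilde (hK : IsMeshOf K Ω) (hS : S ⊆ elements K) {u : Pt d → ℝ}
    (hu : u ∈ Vtilde K r Ω (subdomain S)) : AEBoundedC1 (subdomain S) u := by
  obtain ⟨v, hv, rfl⟩ := hu
  exact aeBoundedC1_restr hK hS hv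

theorem finiteDimensional_Vtilde (hK : IsMeshOf K Ω) (Ω' : Set (Pt d)) :
    FiniteDimensional ℝ (Vtilde K r Ω Ω') := by
  have := finiteDimensional_Vh (r := r) hK
  exact Module.Finite.map _ _

/-- Passes from open elements, where the gradient is known, to closed ones, where the estimates on
compact convex bodies apply. -/
theorem exists_polyFun_integral {v : Pt d → ℝ} (hv : v ∈ Vh K r Ω) (hS : S ⊆ elements K)
    {T : Finset (Pt d)} (hT : T ∈ S) :
    ∃ p : MvPolynomial (Fin d) ℝ, p.totalDegree ≤ r ∧
      (∀ x ∈ convexHull ℝ (T : Set (Pt d)), v x = polyFun p x) ∧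
      ∫ x in interior (convexHull ℝ (T : Set (Pt d))), restr (subdomain S) v x ^ 2 =
        ∫ x in convexHull ℝ (T : Set (Pt d)), polyFun p x ^ 2 ∧
      ∫ x in interior (convexHull ℝ (T : Set (Pt d))), ‖gradient (restr (subdomain S) v) x‖ ^ 2 =
        ∫ x in convexHull ℝ (T : Set (Pt d)), ‖polyGrad p x‖ ^ 2 := by
  obtain ⟨p, hp, hpe, hpi⟩ := exists_polyFun_of_mem_Vh hv hS hT
  refine ⟨p, hp, hpe, ?_, ?_⟩
  · rw [← setIntegral_congr_set (interior_element_ae_eq T)]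
    exact setIntegral_congr_fun isOpen_interior.measurableSet fun x hx => by
      simp only [(hpi x hx).1]
  · rw [← setIntegral_congr_set (interior_element_ae_eq T)]
    exact setIntegral_congr_fun isOpen_interior.measurableSet fun x hx => by
      simp only [(hpi x hx).2.gradient]

theorem volume_element_pos {T : Finset (Pt d)} (hT : T ∈ elements K) :
    0 < volume.real (convexHull ℝ (T : Set (Pt d))) := by
  rw [measureReal_def, ENNReal.toReal_pos_iff]
  refine ⟨?_, (isCompact_element T).measure_lt_top⟩
  exact (isOpen_interior.measure_pos volume (interior_element_nonempty hT)).trans_le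
    (measure_mono interior_subset)

theorem IsMeshOf.diam_le_meshSize (hK : IsMeshOf K Ω) {T : Finset (Pt d)} (hT : T ∈ elements K) :
    Metric.diam (convexHull ℝ (T : Set (Pt d))) ≤ meshSize K :=
  le_csSup (hK.finite_elements.image _).bddAbove ⟨T, hT, rfl⟩

/-- Poincaré's inequality for finite element functions with a zero in each element. -/
theorem normSq_le_gradSq {C : ℝ} (hC : 0 < C)
    (H : ∀ p : MvPolynomial (Fin d) ℝ, p.totalDegree ≤ r → ∀ T : Set (Pt d), Convex ℝ T →
      IsCompact T → ∀ x ∈ T, ∀ y ∈ T, volume.real T * (polyFun p x - polyFun p y) ^ 2 ≤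
        C * Metric.diam T ^ 2 * ∫ z in T, ‖polyGrad p z‖ ^ 2)
    (hK : IsMeshOf K Ω) (hS : S ⊆ elements K) {v : Pt d → ℝ} (hv : v ∈ Vh K r Ω)
    (h0 : ∀ T ∈ S, ∃ x ∈ convexHull ℝ (T : Set (Pt d)), v x = 0) :
    normSq (subdomain S) (restr (subdomain S) v) ≤
      C * meshSize K ^ 2 * gradSq (subdomain S) (restr (subdomain S) v) := by
  have hfin := volume_subdomain_ne_top (hK.finite_elements.subset hS)
  have hbd := aeBoundedC1_restr hK hS hv
  rw [normSq, gradSq, integral_subdomain hK hS (integrableOn_normSq hfin hbd),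
    integral_subdomain hK hS (integrableOn_gradSq hfin hbd), Finset.mul_sum]
  refine Finset.sum_le_sum fun T hT => ?_
  have hTS : T ∈ S := by simpa using hT
  obtain ⟨p, hp, hpe, h1, h2⟩ := exists_polyFun_integral hv hS hTS
  rw [h1, h2]
  obtain ⟨y, hy, hvy⟩ := h0 T hTS
  rw [hpe y hy] at hvy
  have hTc := isCompact_element T
  have hpos := volume_element_pos (hS hTS)
  set I := ∫ x in convexHull ℝ (T : Set (Pt d)), ‖polyGrad p x‖ ^ 2 with hI
  have hI0 : 0 ≤ I := integral_nonneg fun _ => sq_nonneg _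
  have hdiam : Metric.diam (convexHull ℝ (T : Set (Pt d))) ^ 2 ≤ meshSize K ^ 2 :=
    pow_le_pow_left₀ Metric.diam_nonneg (hK.diam_le_meshSize (hS hTS)) 2
  -- Comparison with the zero `y` bounds `p ^ 2` by a constant; integrating it over the element
  -- cancels the volume.
  have hb : ∀ x ∈ convexHull ℝ (T : Set (Pt d)), polyFun p x ^ 2 ≤
      C * meshSize K ^ 2 * I / volume.real (convexHull ℝ (T : Set (Pt d))) := by
    intro x hx
    have h3 := H p hp _ (convex_convexHull ℝ _) hTc x hx y hy
    rw [hvy, sub_zero] at h3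
    rw [le_div_iff₀ hpos, mul_comm]
    refine h3.trans ?_
    gcongr
  have h4 := setIntegral_mono_on (μ := volume)
    (((continuous_polyFun p).pow 2).continuousOn.integrableOn_compact hTc)
    (integrableOn_const (hs := hTc.measure_lt_top.ne)) hTc.measurableSet hb
  rw [setIntegral_const, smul_eq_mul, mul_div_cancel₀ _ hpos.ne'] at h4
  exact h4

/-- Finite element functions without gradient on the subdomain are constant on its elements. -/
theorem eq_of_gradSq_eq_zero (hK : IsMeshOf K Ω) (hS : S ⊆ elements K) {v : Pt d → ℝ}
    (hv : v ∈ Vh K r Ω) (h0 : gradSq (subdomain S) (restr (subdomain S) v) = 0)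
    {T : Finset (Pt d)} (hT : T ∈ S) {x y : Pt d} (hx : x ∈ convexHull ℝ (T : Set (Pt d)))
    (hy : y ∈ convexHull ℝ (T : Set (Pt d))) : v x = v y := by
  have hfin := volume_subdomain_ne_top (hK.finite_elements.subset hS)
  obtain ⟨C, hC, H⟩ := exists_sub_sq_le_setIntegral d r
  obtain ⟨p, hp, hpe, -, h2⟩ := exists_polyFun_integral hv hS hT
  have h3 : ∫ x in convexHull ℝ (T : Set (Pt d)), ‖polyGrad p x‖ ^ 2 ≤ 0 := by
    rw [← h2, ← h0]
    exact setIntegral_mono_set (integrableOn_gradSq hfin (aeBoundedC1_restr hK hS hv))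
      (Filter.Eventually.of_forall fun _ => sq_nonneg _)
      (Filter.Eventually.of_forall (interior_subset_subdomain hT))
  have h4 := H p hp _ (convex_convexHull ℝ _) (isCompact_element T) x hx y hy
  have h5 : C * Metric.diam (convexHull ℝ (T : Set (Pt d))) ^ 2 *
      ∫ x in convexHull ℝ (T : Set (Pt d)), ‖polyGrad p x‖ ^ 2 ≤ 0 :=
    mul_nonpos_of_nonneg_of_nonpos (by positivity) h3
  have h6 := nonpos_of_mul_nonpos_right (h4.trans h5) (volume_element_pos (hS hT))
  rw [hpe x hx, hpe y hy]
  nlinarith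

/-- Finite element functions without gradient are constant on connected subdomains. -/
theorem restr_eq_zero_of_gradSq_eq_zero (hK : IsMeshOf K Ω) (hS : S ⊆ elements K)
    (hconn : IsPreconnected (subdomain S)) {v : Pt d → ℝ} (hv : v ∈ Vh K r Ω)
    (h0 : gradSq (subdomain S) (restr (subdomain S) v) = 0) {y : Pt d} (hy : y ∈ subdomain S)
    (hvy : v y = 0) : restr (subdomain S) v = 0 := by
  have hSf := hK.finite_elements.subset hS
  -- One value per element leaves finitely many values, and a connected finite set of reals is a
  -- point. No chain of adjacent elements is needed.
  have hfin : (v '' subdomain S).Finite := by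
    refine Set.Finite.subset (s := ⋃ T ∈ S, v '' convexHull ℝ (T : Set (Pt d)))
      (hSf.biUnion fun T hT => ?_) ?_
    · refine Set.Subsingleton.finite ?_
      rintro _ ⟨x, hx, rfl⟩ _ ⟨x', hx', rfl⟩
      exact eq_of_gradSq_eq_zero hK hS hv h0 hT hx hx'
    · rw [← image_iUnion₂]
      exact image_mono interior_subset
  have hsub : (v '' subdomain S).Subsingleton :=
    hfin.countable.isTotallyDisconnected _ Subset.rfl (hconn.image v hv.1.continuousOn)
  funext x
  by_cases hx : x ∈ subdomain S
  · change (subdomain S).indicator v x = 0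
    rw [indicator_of_mem hx, ← hvy]
    exact hsub ⟨x, hx, rfl⟩ ⟨y, hy, rfl⟩
  · exact indicator_of_notMem hx v

/-- Continuity of `v` upgrades vanishing almost everywhere to vanishing at each point, in particular
at the nodes. -/
theorem eq_zero_of_normSq_eq_zero (hK : IsMeshOf K Ω) (hS : S ⊆ elements K) {v : Pt d → ℝ}
    (hv : v ∈ Vh K r Ω) (h0 : normSq (subdomain S) (restr (subdomain S) v) = 0) {x : Pt d}
    (hx : x ∈ subdomain S) : v x = 0 := by
  have hfin := volume_subdomain_ne_top (hK.finite_elements.subset hS)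
  have h1 := (integral_eq_zero_iff_of_nonneg (fun _ => sq_nonneg _)
    (integrableOn_normSq hfin (aeBoundedC1_restr hK hS hv))).1 h0
  have h2 : v =ᵐ[volume.restrict (subdomain S)] fun _ => 0 := by
    filter_upwards [h1, ae_restrict_mem (isOpen_subdomain S).measurableSet] with y hy hyS
    have : (subdomain S).indicator v y ^ 2 = 0 := hy
    rw [indicator_of_mem hyS] at this
    exact pow_eq_zero_iff two_ne_zero |>.1 this
  exact Measure.eqOn_open_of_ae_eq h2 (isOpen_subdomain S) hv.1.continuousOn continuousOn_const hx

end Subdomain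

/-! ### The local eigenvalue problems -/

section Abstract

variable {X : Type*} [AddCommGroup X] [Module ℝ X]

theorem mem_kerForm_iff {V : Submodule ℝ X} {c : X → X → ℝ} {C : V →ₗ[ℝ] V →ₗ[ℝ] ℝ}
    (hC : ∀ u v, C u v = c u v) {v : X} :
    v ∈ kerForm V c ↔ ∃ h : v ∈ V, (⟨v, h⟩ : V) ∈ LinearMap.ker C := by
  constructor
  · rintro ⟨hv, h⟩
    refine ⟨hv, ?_⟩
    rw [LinearMap.mem_ker]
    ext w
    rw [hC]; exact h w w.2
  · rintro ⟨hv, h⟩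
    refine ⟨hv, fun w hw => ?_⟩
    have := LinearMap.congr_fun (LinearMap.mem_ker.1 h) ⟨w, hw⟩
    rwa [hC] at this

theorem finrank_kerForm {V : Submodule ℝ X} {c : X → X → ℝ} {C : V →ₗ[ℝ] V →ₗ[ℝ] ℝ}
    (hC : ∀ u v, C u v = c u v) :
    Set.finrank ℝ (kerForm V c) = Module.finrank ℝ (LinearMap.ker C) := by
  have : kerForm V c = ((LinearMap.ker C).map V.subtype : Submodule ℝ X) := by
    ext v
    rw [mem_kerForm_iff hC]
    simp
  rw [Set.finrank, this, Submodule.span_eq, Submodule.finrank_map_subtype_eq]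

/-- An orthogonal family of vectors of positive energy spans a positive definite subspace. -/
theorem finrank_span_and_pos_of_orthogonal {B : X →ₗ[ℝ] X →ₗ[ℝ] ℝ} {ι : Type*} [Fintype ι]
    {u : ι → X} (h0 : ∀ i j, i ≠ j → B (u i) (u j) = 0) (h1 : ∀ i, 0 < B (u i) (u i)) :
    Module.finrank ℝ (Submodule.span ℝ (Set.range u)) = Fintype.card ι ∧
      ∀ w ∈ Submodule.span ℝ (Set.range u), w ≠ 0 → 0 < B w w := by
  classical
  have key : ∀ a : ι → ℝ, B (∑ i, a i • u i) (∑ i, a i • u i) =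
      ∑ i, a i ^ 2 * B (u i) (u i) := by
    intro a
    simp only [map_sum, LinearMap.sum_apply, map_smul, LinearMap.smul_apply, smul_eq_mul]
    refine Finset.sum_congr rfl fun i _ => ?_
    rw [Finset.sum_eq_single i]
    · ring
    · intro j _ hj; simp [h0 j i hj]
    · simp
  have hpos : ∀ a : ι → ℝ, a ≠ 0 → 0 < B (∑ i, a i • u i) (∑ i, a i • u i) := by
    intro a ha
    obtain ⟨i, hi⟩ := Function.ne_iff.1 ha
    rw [key]
    exact Finset.sum_pos' (fun j _ => mul_nonneg (sq_nonneg _) (h1 j).le)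
      ⟨i, Finset.mem_univ i, mul_pos (sq_pos_of_ne_zero hi) (h1 i)⟩
  constructor
  · refine finrank_span_eq_card (Fintype.linearIndependent_iff.2 fun a ha i => ?_)
    by_contra hne
    have := hpos a fun h => hne (congrFun h i)
    simp [ha] at this
  · intro w hw hw0
    obtain ⟨a, rfl⟩ := (Submodule.mem_span_range_iff_exists_fun ℝ).1 hw
    refine hpos a fun h => hw0 ?_
    simp [h]

end Abstract

/-! ### Energies of nodal functions, the local forms, and the threshold on connected subdomains. -/

section Local

variable {d r N : ℕ} {K : Mesh d} {Ω : Set (Pt d)} {S : Set (Finset (Pt d))}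
  {A : Pt d → Matrix (Fin d) (Fin d) ℝ} {n : Pt d → ℝ} {amax nmin k : ℝ}

theorem restr_phi_mem_Vtilde (hK : IsMeshOf K Ω) (hr : 1 ≤ r) {α : Pt d →₀ ℕ}
    (hα : α ∈ dofs K r Ω) (Ω' : Set (Pt d)) : restr Ω' (phi K r α) ∈ Vtilde K r Ω Ω' :=
  ⟨_, phi_mem_Vh hK hr hα, rfl⟩

/-- Nodal basis functions have positive energy if `h k` is small. -/
theorem bForm_phi_pos {C : ℝ} (hC : 0 < C)
    (H : ∀ p : MvPolynomial (Fin d) ℝ, p.totalDegree ≤ r → ∀ T : Set (Pt d), Convex ℝ T →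
      IsCompact T → ∀ x ∈ T, ∀ y ∈ T, volume.real T * (polyFun p x - polyFun p y) ^ 2 ≤
        C * Metric.diam T ^ 2 * ∫ z in T, ‖polyGrad p z‖ ^ 2)
    (hd : 1 ≤ d) (hr : 1 ≤ r) (hK : IsMeshOf K Ω) (hS : S ⊆ elements K)
    (hA : IsCoefficients (subdomain S) A n amax nmin) (hk : 0 < k)
    (hhk : (meshSize K * k) ^ 2 ≤ 1 / (2 * C)) {α : Pt d →₀ ℕ}
    (hα : α ∈ dofInt K r Ω (subdomain S)) :
    0 < bForm A n k (subdomain S) (restr (subdomain S) (phi K r α))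
      (restr (subdomain S) (phi K r α)) := by
  have hfin := volume_subdomain_ne_top (hK.finite_elements.subset hS)
  have hv := phi_mem_Vh hK hr hα.1
  have hbd := aeBoundedC1_restr hK hS hv
  have h1 := normSq_le_gradSq hC H hK hS hv fun T hT => exists_phi_eq_zero hd hα.1 (hS hT)
  have h2 := gradSq_le_aForm hA hfin hbd
  have h3 := nForm_le_normSq hA hfin hbd
  have hL : 0 < normSq (subdomain S) (restr (subdomain S) (phi K r α)) := by
    refine lt_of_le_of_ne normSq_nonneg fun h => ?_
    have := eq_zero_of_normSq_eq_zero hK hS hv h.symm (node_mem_subdomain hK hr ⟨S, hS, rfl⟩ hα)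
    rw [phi_node hr hα.1 hα.1, if_pos rfl] at this
    exact one_ne_zero this
  set u := restr (subdomain S) (phi K r α) with hu
  have hG : 0 ≤ gradSq (subdomain S) u := gradSq_nonneg
  -- The factor `1 / 2` leaves room: the energy is at least `gradSq - k² normSq ≥ k² normSq`, which
  -- is positive.
  have h4 : k ^ 2 * normSq (subdomain S) u ≤ 1 / 2 * gradSq (subdomain S) u := by
    calc k ^ 2 * normSq (subdomain S) u
        ≤ k ^ 2 * (C * meshSize K ^ 2 * gradSq (subdomain S) u) := by gcongr
      _ = C * (meshSize K * k) ^ 2 * gradSq (subdomain S) u := by ring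
      _ ≤ C * (1 / (2 * C)) * gradSq (subdomain S) u := by gcongr
      _ = 1 / 2 * gradSq (subdomain S) u := by field_simp
  have h5 : 0 < k ^ 2 * normSq (subdomain S) u := by positivity
  have h6 : k ^ 2 * nForm n (subdomain S) u u ≤ k ^ 2 * normSq (subdomain S) u := by gcongr
  rw [bForm]
  linarith

theorem finite_dofInt (hK : IsMeshOf K Ω) (Ω' : Set (Pt d)) : (dofInt K r Ω Ω').Finite :=
  (finite_dofs hK).subset fun _ h => h.1

theorem Xi_eq_sum (hK : IsMeshOf K Ω) (Ωc : Fin N → Set (Pt d)) (i : Fin N) (v : Pt d → ℝ) :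
    Xi K r Ω Ωc i v = ∑ α ∈ (finite_dofInt (r := r) hK (Ωc i)).toFinset,
      ((mu K r Ω Ωc α : ℝ)⁻¹ * v (node r α)) • restr (Ωc i) (phi K r α) :=
  finsum_mem_eq_finite_toFinset_sum _ _

theorem mu_ne_zero {Ωc : Fin N → Set (Pt d)} {i : Fin N} {α : Pt d →₀ ℕ}
    (hα : α ∈ dofInt K r Ω (Ωc i)) : mu K r Ω Ωc α ≠ 0 :=
  ((Set.ncard_pos (Set.toFinite _)).2 ⟨i, hα⟩).ne'

/-- The local forms are symmetric and bilinear, `c_i` is positive semidefinite, and functions in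
its kernel vanish at the interior nodes. -/
theorem exists_local_forms (hr : 1 ≤ r) (hK : IsMeshOf K Ω) {Ωc : Fin N → Set (Pt d)} {i : Fin N}
    (hΩc : IsMeshSubdomain K (Ωc i)) (hA : IsCoefficients (Ωc i) A n amax nmin) (hk : 0 < k) :
    ∃ B C : Vtilde K r Ω (Ωc i) →ₗ[ℝ] Vtilde K r Ω (Ωc i) →ₗ[ℝ] ℝ,
      (∀ u v, B u v = bForm A n k (Ωc i) u v) ∧ (∀ u v, C u v = cForm K r Ω A n k Ωc i u v) ∧
      (∀ u v, B u v = B v u) ∧ (∀ u v, C u v = C v u) ∧ (∀ v, 0 ≤ C v v) ∧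
      ∀ v ∈ LinearMap.ker C, ∀ α ∈ dofInt K r Ω (Ωc i), (v : Pt d → ℝ) (node r α) = 0 := by
  obtain ⟨S, hS, hΩS⟩ := id hΩc
  change Ωc i = subdomain S at hΩS
  have hfin : volume (Ωc i) ≠ ⊤ := by
    rw [hΩS]; exact volume_subdomain_ne_top (hK.finite_elements.subset hS)
  have hV : ∀ u ∈ Vtilde K r Ω (Ωc i), AEBoundedC1 (Ωc i) u := by
    rw [hΩS]; exact fun u hu => aeBoundedC1_of_mem_Vtilde hK hS hu
  obtain ⟨a, m, ha, hm⟩ := exists_bilinear_aForm_nForm hA hfin hV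
  let X₀ : (Pt d → ℝ) →ₗ[ℝ] (Pt d → ℝ) := ∑ α ∈ (finite_dofInt (r := r) hK (Ωc i)).toFinset,
    ((mu K r Ω Ωc α : ℝ)⁻¹ • (LinearMap.proj (node r α) : (Pt d → ℝ) →ₗ[ℝ] ℝ)).smulRight
      (restr (Ωc i) (phi K r α))
  have hX₀ : ∀ v, X₀ v = Xi K r Ω Ωc i v := by
    intro v
    rw [Xi_eq_sum hK, LinearMap.sum_apply]
    exact Finset.sum_congr rfl fun α _ => rfl
  have hX₀V : ∀ v ∈ Vtilde K r Ω (Ωc i), X₀ v ∈ Vtilde K r Ω (Ωc i) := by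
    intro v _
    rw [hX₀, Xi_eq_sum hK]
    refine Submodule.sum_mem _ fun α hα => Submodule.smul_mem _ _ ?_
    exact restr_phi_mem_Vtilde hK hr ((Set.Finite.mem_toFinset _).1 hα).1 _
  let X := X₀.restrict hX₀V
  have hX : ∀ v, (X v : Pt d → ℝ) = Xi K r Ω Ωc i v := fun v => hX₀ v
  have hCe : ∀ u v, (a + k ^ 2 • m).compl₁₂ X X u v = cForm K r Ω A n k Ωc i u v := by
    intro u v
    rw [cForm, ← hX, ← hX, energyForm, ← ha, ← hm]
    rfl
  -- This lower bound yields semidefiniteness and shows that `Ξ_i v` vanishes almost everywhere on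
  -- the subdomain for `v` in the kernel.
  have hge : ∀ v, k ^ 2 * (nmin * normSq (Ωc i) (X v)) ≤ (a + k ^ 2 • m).compl₁₂ X X v v := by
    intro v
    have h1 := gradSq_le_aForm hA hfin (hV _ (X v).2)
    have h2 := mul_normSq_le_nForm hA hfin (hV _ (X v).2)
    have h3 : 0 ≤ gradSq (Ωc i) (X v) := gradSq_nonneg
    have h4 : k ^ 2 * (nmin * normSq (Ωc i) (X v)) ≤ k ^ 2 * nForm n (Ωc i) (X v) (X v) := by
      gcongr
    rw [hCe, cForm, ← hX, energyForm]
    linarith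
  refine ⟨a - k ^ 2 • m, (a + k ^ 2 • m).compl₁₂ X X, fun u v => ?_, hCe, fun u v => ?_,
    fun u v => ?_, fun v => ?_, fun v hv α hα => ?_⟩
  · rw [bForm, ← ha, ← hm]; rfl
  · simp only [LinearMap.sub_apply, LinearMap.smul_apply, ha, hm]
    rw [aForm_comm hA, nForm_comm]
  · simp only [LinearMap.compl₁₂_apply, LinearMap.add_apply, LinearMap.smul_apply, ha, hm]
    rw [aForm_comm hA, nForm_comm]
  · refine le_trans ?_ (hge v)
    have := hA.nmin_pos
    have := normSq_nonneg (Ω' := Ωc i) (u := (X v : Pt d → ℝ))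
    positivity
  · have h1 := hge v
    rw [LinearMap.mem_ker.1 hv, LinearMap.zero_apply] at h1
    have h2 := hA.nmin_pos
    have h3 : normSq (Ωc i) (X v) = 0 := by
      refine le_antisymm ?_ normSq_nonneg
      by_contra! h
      have hpos : 0 < k ^ 2 * (nmin * normSq (Ωc i) (X v)) := by positivity
      exact absurd h1 (not_le.2 hpos)
    -- The global finite element function `w` restricts to `Ξ_i v`. Being continuous, it can be
    -- evaluated at nodes, where the Kronecker property isolates `v_α / μ_α`.
    let w : Pt d → ℝ := ∑ β ∈ (finite_dofInt (r := r) hK (Ωc i)).toFinset,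
      ((mu K r Ω Ωc β : ℝ)⁻¹ * (v : Pt d → ℝ) (node r β)) • phi K r β
    have hw : w ∈ Vh K r Ω := Submodule.sum_mem _ fun β hβ => Submodule.smul_mem _ _
      (phi_mem_Vh hK hr ((Set.Finite.mem_toFinset _).1 hβ).1)
    have hXw : (X v : Pt d → ℝ) = restr (Ωc i) w := by
      rw [hX, Xi_eq_sum hK, map_sum]
      simp only [map_smul]
    rw [hXw, hΩS] at h3
    have hmem := node_mem_subdomain hK hr hΩc hα
    rw [hΩS] at hmem
    have h4 := eq_zero_of_normSq_eq_zero hK hS hw h3 hmem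
    have h5 : w (node r α) = (mu K r Ω Ωc α : ℝ)⁻¹ * (v : Pt d → ℝ) (node r α) := by
      simp only [w, Finset.sum_apply, Pi.smul_apply, smul_eq_mul]
      rw [Finset.sum_eq_single α]
      · rw [phi_node hr hα.1 hα.1, if_pos rfl, mul_one]
      · intro β hβ hne
        rw [phi_node hr ((Set.Finite.mem_toFinset _).1 hβ).1 hα.1, if_neg hne, mul_zero]
      · intro h; exact absurd ((Set.Finite.mem_toFinset _).2 hα) h
    rw [h5] at h4
    refine (mul_eq_zero.1 h4).resolve_left (inv_ne_zero ?_)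
    exact_mod_cast mu_ne_zero hα

/-- Poincaré's inequality on a connected subdomain for finite element functions that vanish at a
given point. -/
theorem exists_normSq_le_gradSq (hK : IsMeshOf K Ω) (hS : S ⊆ elements K)
    (hconn : IsPreconnected (subdomain S)) {y : Pt d} (hy : y ∈ subdomain S) :
    ∃ c : ℝ, 0 < c ∧ ∀ u ∈ Vtilde K r Ω (subdomain S), u y = 0 →
      (u ≠ 0 → 0 < gradSq (subdomain S) u) ∧
      normSq (subdomain S) u ≤ c * gradSq (subdomain S) u := by
  have hfin := volume_subdomain_ne_top (hK.finite_elements.subset hS)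
  -- Vanishing at `y` excludes nonzero constants, so the Dirichlet integral is definite on this
  -- finite-dimensional space and dominates the `L²` norm.
  let V₀ : Submodule ℝ (Pt d → ℝ) := Vtilde K r Ω (subdomain S) ⊓
    LinearMap.ker (LinearMap.proj y : (Pt d → ℝ) →ₗ[ℝ] ℝ)
  have := finiteDimensional_Vtilde (r := r) hK (subdomain S)
  have : FiniteDimensional ℝ V₀ := Submodule.finiteDimensional_of_le inf_le_left
  have hpos : ∀ u ∈ V₀, u ≠ 0 → 0 < gradSq (subdomain S) u := by
    rintro _ ⟨⟨v, hv, rfl⟩, hvy⟩ hne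
    refine lt_of_le_of_ne gradSq_nonneg fun h => hne ?_
    refine restr_eq_zero_of_gradSq_eq_zero hK hS hconn hv h.symm hy ?_
    have : (subdomain S).indicator v y = 0 := hvy
    rwa [indicator_of_mem hy] at this
  obtain ⟨a, m, ha, hm⟩ := exists_bilinear_aForm_nForm (isCoefficients_one (subdomain S)) hfin
    (V := V₀) fun u hu => aeBoundedC1_of_mem_Vtilde hK hS hu.1
  obtain ⟨c, hc, h⟩ := exists_apply_self_le (L := m) (G := a)
    (fun u v => by rw [hm, hm, nForm_comm])
    (fun u v => by rw [ha, ha, aForm_comm (isCoefficients_one _)])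
    (fun v hv => by
      rw [ha, ← gradSq_eq_aForm]
      exact hpos v v.2 fun h => hv (Subtype.ext h))
  refine ⟨c, hc, fun u hu hu0 => ⟨hpos u ⟨hu, hu0⟩, ?_⟩⟩
  have := h ⟨u, hu, hu0⟩
  rwa [hm, ha, ← gradSq_eq_aForm, ← normSq_eq_nForm] at this

theorem meshSize_pos (hd : 1 ≤ d) (hK : IsMeshOf K Ω) {T : Finset (Pt d)} (hT : T ∈ elements K) :
    0 < meshSize K := by
  obtain ⟨v, hv⟩ := Geometry.SimplicialComplex.nonempty_of_mem_faces hT.1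
  obtain ⟨w, hw, hne⟩ := Finset.exists_mem_ne (s := T) (by have := hT.2; omega) v
  refine lt_of_lt_of_le (dist_pos.2 hne) (le_trans ?_ (hK.diam_le_meshSize hT))
  exact Metric.dist_le_diam_of_mem (isCompact_element T).isBounded (subset_convexHull ℝ _ hw)
    (subset_convexHull ℝ _ hv)

open Filter Topology in
/-- A threshold for `h k` below which `b_i` is positive on functions that vanish at an interior
node, for all connected subdomains at once. -/
theorem exists_uniform_threshold (hd : 1 ≤ d) (hr : 1 ≤ r) (hK : IsMeshOf K Ω)
    {Ωc : Fin N → Set (Pt d)} (hΩc : ∀ i, IsMeshSubdomain K (Ωc i)) :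
    ∃ C₁ : ℝ, 0 < C₁ ∧ ∀ i, ∀ α ∈ dofInt K r Ω (Ωc i), IsConnected (Ωc i) →
      ∀ (A : Pt d → Matrix (Fin d) (Fin d) ℝ) (n : Pt d → ℝ) (amax nmin : ℝ),
        IsCoefficients (Ωc i) A n amax nmin → ∀ k : ℝ, (meshSize K * k) ^ 2 ≤ C₁ →
          ∀ u ∈ Vtilde K r Ω (Ωc i), u (node r α) = 0 → u ≠ 0 → 0 < bForm A n k (Ωc i) u u := by
  -- Phrasing the threshold as "for all small `ε`" lets the finitely many pairs of subdomain and
  -- node share one value.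
  have key : ∀ i : Fin N, ∀ α ∈ dofInt K r Ω (Ωc i), ∀ᶠ ε in 𝓝[>] (0 : ℝ),
      IsConnected (Ωc i) →
      ∀ (A : Pt d → Matrix (Fin d) (Fin d) ℝ) (n : Pt d → ℝ) (amax nmin : ℝ),
        IsCoefficients (Ωc i) A n amax nmin → ∀ k : ℝ, (meshSize K * k) ^ 2 ≤ ε →
          ∀ u ∈ Vtilde K r Ω (Ωc i), u (node r α) = 0 → u ≠ 0 →
            0 < bForm A n k (Ωc i) u u := by
    intro i α hα
    by_cases hconn : IsConnected (Ωc i)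
    swap
    · exact Eventually.of_forall fun _ h => absurd h hconn
    have hnode := node_mem_subdomain hK hr (hΩc i) hα
    obtain ⟨S, hS, hΩS⟩ := hΩc i
    change Ωc i = subdomain S at hΩS
    rw [hΩS] at hnode hconn ⊢
    have hfin := volume_subdomain_ne_top (hK.finite_elements.subset hS)
    obtain ⟨T, hT⟩ : ∃ T, T ∈ S := by
      have := interior_subset hnode
      simp only [mem_iUnion] at this
      obtain ⟨T, hT, -⟩ := this
      exact ⟨T, hT⟩
    have hh := meshSize_pos hd hK (hS hT)
    obtain ⟨c, hc, H⟩ := exists_normSq_le_gradSq (r := r) hK hS hconn.isPreconnected hnode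
    -- Below this value `(hk)² ≤ ε` gives `k² c ≤ 1/2` after cancelling `h² > 0`.
    have hmem : Ioo (0 : ℝ) (meshSize K ^ 2 / (2 * c)) ∈ 𝓝[>] (0 : ℝ) :=
      Ioo_mem_nhdsGT (by positivity)
    filter_upwards [hmem] with ε hε _ A n amax nmin hA k hk u hu hu0 hne
    obtain ⟨hpos, hle⟩ := H u hu hu0
    have hG := hpos hne
    have hbd := aeBoundedC1_of_mem_Vtilde hK hS hu
    have h1 := gradSq_le_aForm hA hfin hbd
    have h2 := nForm_le_normSq hA hfin hbd
    have hk2 : k ^ 2 * c ≤ 1 / 2 := by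
      have h3 := hk.trans hε.2.le
      rw [le_div_iff₀ (by positivity), mul_pow] at h3
      have h4 : meshSize K ^ 2 * (k ^ 2 * c * 2) ≤ meshSize K ^ 2 * 1 := by linarith
      have h5 := le_of_mul_le_mul_left h4 (by positivity)
      linarith
    have h3 : k ^ 2 * nForm n (subdomain S) u u ≤ 1 / 2 * gradSq (subdomain S) u := by
      calc k ^ 2 * nForm n (subdomain S) u u
          ≤ k ^ 2 * (c * gradSq (subdomain S) u) := by gcongr; exact h2.trans hle
        _ = k ^ 2 * c * gradSq (subdomain S) u := by ring
        _ ≤ 1 / 2 * gradSq (subdomain S) u := by gcongr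
    rw [bForm]
    linarith
  have hall := eventually_all.2 fun i => (eventually_all_finite (finite_dofInt hK (Ωc i))).2 (key i)
  obtain ⟨ε, hε, hε0⟩ := (hall.and self_mem_nhdsWithin).exists
  exact ⟨ε, hε0, hε⟩

end Local

end HkGenEO

/-! ### The positivity theorem. -/

theorem theorem3p5 (d r : ℕ) (hd : 1 ≤ d) (hr : 1 ≤ r) :
    ∃ C_pos : ℝ, 0 < C_pos ∧
      ∀ (Ω : Set (Pt d)) (K : Mesh d), IsMeshOf K Ω →
      ∀ (N : ℕ) (Ωc : Fin N → Set (Pt d)),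
        (∀ i, IsMeshSubdomain K (Ωc i)) → (⋃ i, Ωc i) = Ω →
      ∃ C_1 : ℝ, 0 < C_1 ∧
      ∀ (A : Pt d → Matrix (Fin d) (Fin d) ℝ) (n : Pt d → ℝ) (amax nmin : ℝ),
        IsCoefficients Ω A n amax nmin →
      ∀ k : ℝ, 0 < k →
      -- each subdomain has `s_i + 1` interior degrees of freedom, `s_i = dim ker c_i`,
      -- whose basis functions have supports with pairwise null intersections
      (∀ i, ∃ D : Finset (Pt d →₀ ℕ),
        D.card = Set.finrank ℝ (kerForm (Vtilde K r Ω (Ωc i)) (cForm K r Ω A n k Ωc i)) + 1 ∧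
        (∀ l ∈ D, l ∈ dofInt K r Ω (Ωc i)) ∧
        ∀ l ∈ D, ∀ l' ∈ D, l ≠ l' →
          MeasureTheory.volume
            (tsupport (restr (Ωc i) (phi K r l)) ∩ tsupport (restr (Ωc i) (phi K r l'))) = 0) →
      (meshSize K * k) ^ 2 ≤ C_pos →
      ∀ i,
        -- the problem on `Ωc i` has a positive (finite) eigenvalue
        (∃ (lam : ℝ) (p : Pt d → ℝ), 0 < lam ∧
          IsEigenpair (Vtilde K r Ω (Ωc i)) (bForm A n k (Ωc i)) (cForm K r Ω A n k Ωc i) lam p ∧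
          0 < cForm K r Ω A n k Ωc i p p) ∧
        -- every complete ordered list of its finite eigenvalues has a positive member
        (∀ lam p,
          IsEigensystem (Vtilde K r Ω (Ωc i)) (bForm A n k (Ωc i)) (cForm K r Ω A n k Ωc i)
            lam p → ∃ m, 0 < lam m) ∧
        -- such a list exists as soon as `b_i` is positive definite on `ker c_i`
        ((∀ v ∈ kerForm (Vtilde K r Ω (Ωc i)) (cForm K r Ω A n k Ωc i),
            v ≠ 0 → 0 < bForm A n k (Ωc i) v v) →
          ∃ lam p, IsEigensystem (Vtilde K r Ω (Ωc i)) (bForm A n k (Ωc i))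
            (cForm K r Ω A n k Ωc i) lam p) ∧
        -- which is the case if `Ωc i` is connected and `h k` is small
        (IsConnected (Ωc i) → (meshSize K * k) ^ 2 ≤ C_1 →
          ∀ v ∈ kerForm (Vtilde K r Ω (Ωc i)) (cForm K r Ω A n k Ωc i),
            v ≠ 0 → 0 < bForm A n k (Ωc i) v v) := by
  obtain ⟨C, hC, H⟩ := exists_sub_sq_le_setIntegral d r
  refine ⟨1 / (2 * C), by positivity, fun Ω K hK N Ωc hΩc hcover => ?_⟩
  obtain ⟨C₁, hC₁, H₁⟩ := exists_uniform_threshold (r := r) hd hr hK hΩc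
  refine ⟨C₁, hC₁, fun A n amax nmin hA₀ k hk hD hhk i => ?_⟩
  have hA : IsCoefficients (Ωc i) A n amax nmin :=
    hA₀.mono (hcover ▸ Set.subset_iUnion Ωc i)
  have := finiteDimensional_Vtilde (r := r) hK (Ωc i)
  obtain ⟨B, Cf, hBe, hCe, hB, hCs, hC0, hker⟩ := exists_local_forms hr hK (hΩc i) hA hk
  have hfr := finrank_kerForm hCe
  obtain ⟨D, hDcard, hDmem, hDsupp⟩ := hD i
  let u : D → Vtilde K r Ω (Ωc i) := fun l =>
    ⟨_, restr_phi_mem_Vtilde hK hr (hDmem l l.2).1 (Ωc i)⟩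
  have hu0 : ∀ l l', l ≠ l' → B (u l) (u l') = 0 := by
    intro l l' hne
    obtain ⟨h1, h2⟩ := forms_eq_zero_of_tsupport (Ω' := Ωc i) (A := A) (n := n)
      (hDsupp l l.2 l' l'.2 fun h => hne (Subtype.ext h))
    rw [hBe, bForm, h1, h2, mul_zero, sub_zero]
  have hu1 : ∀ l, 0 < B (u l) (u l) := by
    intro l
    have hl := hDmem l l.2
    obtain ⟨S, hS, hΩS⟩ := hΩc i
    change Ωc i = subdomain S at hΩS
    have hA' := hΩS ▸ hA
    have hl' := hΩS ▸ hl
    rw [hBe]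
    have := bForm_phi_pos hC H hd hr hK hS hA' hk hhk hl'
    rw [← hΩS] at this
    exact this
  obtain ⟨hW, hWpos⟩ := finrank_span_and_pos_of_orthogonal hu0 hu1
  -- The `+ 1` in the number of chosen basis functions is exactly the strict dimension inequality
  -- required here.
  obtain ⟨lam₀, p₀, hlam₀, hp₀, hpe₀⟩ := exists_pos_eigenpair hB hCs hC0 _
    (by rw [hW, Fintype.card_coe, hDcard, hfr]; exact Nat.lt_succ_self _) hWpos
  refine ⟨⟨lam₀, p₀, hlam₀, ⟨p₀.2, fun h => ?_, fun v hv => ?_⟩, ?_⟩, fun lam p hp => ?_,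
    fun hpd => ?_, fun hconn hhk₁ v hv hv0 => ?_⟩
  · rw [show p₀ = 0 from Subtype.ext h] at hp₀
    simp at hp₀
  · have := hpe₀ ⟨v, hv⟩
    rwa [hBe, hCe] at this
  · rwa [hCe] at hp₀
  · obtain ⟨j, hj⟩ := exists_eq_of_eigensystem hB hCs hp₀ hpe₀ (by rw [hfr]) (lam := lam)
      (p := fun j => ⟨p j, (hp.eigenpair j).1⟩)
      (fun j v => by rw [hBe, hCe]; exact (hp.eigenpair j).2.2 v v.2)
      (fun j j' => by rw [hCe]; exact hp.orthonormal j j')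
    exact ⟨j, hj ▸ hlam₀⟩
  · obtain ⟨lam, p, hmono, he, ho⟩ := exists_eigensystem hB hCs hC0
      (fun z hz hz0 => by
        rw [hBe]
        exact hpd z ((mem_kerForm_iff hCe).2 ⟨z.2, hz⟩) fun h => hz0 (Subtype.ext h))
      (m := Module.finrank ℝ (Vtilde K r Ω (Ωc i)) -
        Set.finrank ℝ (kerForm (Vtilde K r Ω (Ωc i)) (cForm K r Ω A n k Ωc i)))
      (by rw [hfr])
    refine ⟨lam, fun j => p j, hmono, fun j => ⟨(p j).2, fun h => ?_, fun v hv => ?_⟩,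
      fun j j' => ?_⟩
    · have h1 := ho j j
      rw [show p j = 0 from Subtype.ext h] at h1
      simp at h1
    · have := he j ⟨v, hv⟩
      rwa [hBe, hCe] at this
    · rw [← ho, hCe]
  · obtain ⟨hvV, hvk⟩ := (mem_kerForm_iff hCe).1 hv
    -- The same `+ 1` guarantees an interior node, at which every kernel function vanishes.
    obtain ⟨l, hl⟩ := Finset.card_pos.1 (show 0 < D.card by omega)
    exact H₁ i l (hDmem l hl) hconn A n amax nmin hA k hhk₁ v hvV
      (hker _ hvk l (hDmem l hl)) hv0
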